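/- **Setting.** Two fuels $I=\{c,g\}$; for $i\in I$ let $j$ denote the other fuel. Fuel $i$ has capacity $\bar\xi^i>0$ and bid curve $b_i(\xi,s)=s\,e^{k_i+m_i\xi}$ with $k_i\in\mathbb R$, $m_i>0$; $\bar\xi=\bar\xi^c+\bar\xi^g$; $i_+$ is a fuel of maximal capacity. Put $\hat b_i^{-1}(p,s)=\bar\xi^i\wedge\inf\{\xi\in(0,\bar\xi^i]: b_i(\xi,s)>p\}$ and let the market bid stack be $$b(\xi,\mathbf s)=\min_{i}b_i(0,s^i)\ \vee\ \sup\Big\{p\in\mathbb R:\ \sum_{i}\hat b_i^{-1}(p,s^i)<\xi\Big\}\qquad(\inf\emptyset=+\infty,\ \sup\emptyset=-\infty).$$ Let $\mathbb Q$ be a probability measure, $(\mathcal F_t)$ a filtration, $0\le t\le T$, and let $S^c_T,S^g_T$ (a.s. positive fuel prices) and $X_T$ (untruncated demand) be $\mathcal F_T$-measurable. Assume that, under $\mathbb Q$ and conditionally on $\mathcal F_t$, $(\log S^c_T,\log S^g_T)$ is bivariate Gaussian with ($\mathcal F_t$-measurable) means $\mu_c,\mu_g$, constant variances $\sigma_c^2,\sigma_g^2$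 and correlation $\rho\in[-1,1]$ (i.e. covariance $\rho\sigma_c\sigma_g$), $X_T\sim N(\mu_d,\sigma_d^2)$ with $\mu_d$ $\mathcal F_t$-measurable and $\sigma_d>0$ constant, and $X_T$ is independent of $(S^c_T,S^g_T)$. Assume $\sigma_c,\sigma_g\ge0$ and $\sigma^2:=\sigma_c^2-2\rho\sigma_c\sigma_g+\sigma_g^2>0$. Demand and electricity price at maturity are $D_T=\max(0,\min(\bar\xi,X_T))$ and $P_T=b(D_T,\mathbf S_T)$; the fuel forward prices are $F^i_t=\mathbb E^{\mathbb Q}[S^i_T|\mathcal F_t]$, $\mathbf F_t=(F^c_t,F^g_t)$. **Notation.** $\Phi_1$ and $\Phi_2(\cdot,\cdot;r)$ are the standard univariate and bivariate (correlation $r$) normal cdfs, $\Delta\Phi_2(x_1,x_2;y;r)=\Phi_2(x_1,y;r)-\Phi_2(x_2,y;r)$. Further $\alpha_i=\frac{m_j}{m_c+m_g}$, $\beta=\frac{k_cm_g+k_gm_c}{m_c+m_g}$, $\gamma=\frac{m_cm_g}{m_c+m_g}$, $b_{cg}(\xi,\mathbf s)=(s^c)^{\alpha_c}(s^g)^{\alpha_g}e^{\beta+\gamma\xi}$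 (all $b_i$, $b_{cg}$ are evaluated by these formulas for any real $\xi$), $\sigma_{i,d}^2=m_i^2\sigma_d^2+\sigma^2$, $\delta_{i}=-1$ if $i=i_+$ and $\delta_i=1$ otherwise, and $$R^{(n)}_i(x,y)=k_j+m_jy-k_i-m_ix+\log F^j_t-\log F^i_t-(n-\tfrac12)\sigma_i^2-\tfrac12\sigma_j^2+n\rho\sigma_i\sigma_j,$$ $$\nu_i^{(n)}=\tfrac12(n^2-n)\sigma_i^2,\qquad \zeta^{(n)}_i=\nu_i^{(n)}+\tfrac12n^2m_i^2\sigma_d^2,$$ $$\eta^{(n)}=\tfrac12(n^2-n)(\alpha_c\sigma_c^2+\alpha_g\sigma_g^2)+\tfrac{n^2}{2}(\gamma^2\sigma_d^2-\alpha_c\alpha_g\sigma^2).$$ **Claim.** For every integer $n\ge0$, almost surely, $$\begin{aligned} \mathbb E^{\mathbb Q}[P_T^n|\mathcal F_t]=\ &\Phi_1\Big(\tfrac{-\mu_d}{\sigma_d}\Big)\sum_{i}b_i^n(0,F^i_t)\,e^{\nu^{(n)}_i}\,\Phi_1\Big(\tfrac{R^{(n)}_i(0,0)}{\sigma}\Big)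 +\Phi_1\Big(\tfrac{\mu_d-\bar\xi}{\sigma_d}\Big)\sum_{i}b_i^n(\bar\xi^i,F^i_t)\,e^{\nu^{(n)}_i}\,\Phi_1\Big(\tfrac{-R^{(n)}_i(\bar\xi^i,\bar\xi^j)}{\sigma}\Big)\\ &+\sum_i b_i^n(\mu_d,F^i_t)\,e^{\zeta^{(n)}_i}\,\Delta\Phi_2\Big(\tfrac{\bar\xi^i-\mu_d}{\sigma_d}-nm_i\sigma_d,\ \tfrac{-\mu_d}{\sigma_d}-nm_i\sigma_d;\ \tfrac{R^{(n)}_i(\mu_d,0)-nm_i^2\sigma_d^2}{\sigma_{i,d}};\ \tfrac{m_i\sigma_d}{\sigma_{i,d}}\Big)\\ &+\sum_i b_i^n(\mu_d-\bar\xi^j,F^i_t)\,e^{\zeta^{(n)}_i}\,\Delta\Phi_2\Big(\tfrac{\bar\xi-\mu_d}{\sigma_d}-nm_i\sigma_d,\ \tfrac{\bar\xi^j-\mu_d}{\sigma_d}-nm_i\sigma_d;\ \tfrac{-R^{(n)}_i(\mu_d-\bar\xi^j,\bar\xi^j)+nm_i^2\sigma_d^2}{\sigma_{i,d}};\ \tfrac{-m_i\sigma_d}{\sigma_{i,d}}\Big)\\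 &+\sum_i\delta_i\,b_{cg}^n(\mu_d,\mathbf F_t)\,e^{\eta^{(n)}}\Big\{-\Delta\Phi_2\Big(\tfrac{\bar\xi^i-\mu_d}{\sigma_d}-n\gamma\sigma_d,\ \tfrac{-\mu_d}{\sigma_d}-n\gamma\sigma_d;\ \tfrac{R^{(n)}_i(\mu_d,0)+n\alpha_j\sigma^2-n\gamma m_i\sigma_d^2}{\delta_i\sigma_{i,d}};\ \tfrac{m_i\sigma_d}{\delta_i\sigma_{i,d}}\Big)\\ &\qquad+\Delta\Phi_2\Big(\tfrac{\bar\xi-\mu_d}{\sigma_d}-n\gamma\sigma_d,\ \tfrac{\bar\xi^j-\mu_d}{\sigma_d}-n\gamma\sigma_d;\ \tfrac{R^{(n)}_i(\mu_d-\bar\xi^j,\bar\xi^j)+n\alpha_j\sigma^2-n\gamma m_i\sigma_d^2}{\delta_i\sigma_{i,d}};\ \tfrac{m_i\sigma_d}{\delta_i\sigma_{i,d}}\Big)\Big\}. \end{aligned}$$ Here conditional expectations are those of nonnegative random variables (no integrability is needed; $P_T\ge0$ a.s.); when $P_T^n$ is $\mathbb Q$-integrable the left side is the usual conditional expectation. 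-/

import Mathlib

open MeasureTheory ProbabilityTheory
open scoped NNReal ENNReal

noncomputable section

namespace BidStack

/-! ### Market bid stack of a finite family of fuels -/

/-- Exponential fuel bid curve `b(ξ, s) = s exp (k + m ξ)`. -/
def expBid (k m ξ s : ℝ) : ℝ := s * Real.exp (k + m * ξ)

/-- Generalized right-continuous inverse of `ξ ↦ b ξ s` for a fuel of capacity `cap`:
`cap ∧ inf {ξ ∈ (0, cap] : b ξ s > p}`, where the infimum of the empty set is `+∞`
(inserting `cap` into the set realises both the minimum and this convention). -/
def bidInv (b : ℝ → ℝ → ℝ) (cap p s : ℝ) : ℝ :=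
  sInf (insert cap {ξ : ℝ | ξ ∈ Set.Ioc 0 cap ∧ p < b ξ s})

/-- Market bid stack: the price at which the last unit needed to satisfy the demand `ξ` is sold,
`min_i b_i(0, s_i) ∨ sup {p : ∑ i, b̂_i⁻¹(p, s_i) < ξ}`, where the supremum of the empty set is
`-∞` (inserting the minimum into the set realises both the maximum and this convention). -/
def marketBid {ι : Type*} [Fintype ι] (b : ι → ℝ → ℝ → ℝ) (cap : ι → ℝ) (ξ : ℝ) (s : ι → ℝ) : ℝ :=
  sSup (insert (⨅ i, b i 0 (s i)) {p : ℝ | ∑ i, bidInv (b i) (cap i) p (s i) < ξ})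

/-! ### Gaussian distribution functions -/

/-- Standard normal distribution function. -/
def Phi1 (x : ℝ) : ℝ := cdf (gaussianReal 0 1) x

/-- Distribution function of the bivariate standard normal law with correlation `r`. -/
def Phi2 (x y r : ℝ) : ℝ :=
  (multivariateGaussian (0 : EuclideanSpace ℝ (Fin 2)) !![1, r; r, 1]).real
    {z | z 0 ≤ x ∧ z 1 ≤ y}

/-- `Φ₂(x₁, y; r) - Φ₂(x₂, y; r)`. -/
def Phi2Diff (x₁ x₂ y r : ℝ) : ℝ := Phi2 x₁ y r - Phi2 x₂ y r

/-! ### Conditional laws and conditional expectations -/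

/-- `κ` is the conditional law of `Y` given the sub-σ-algebra `m`:
for every measurable set `A`, `Q(Y ∈ A | m) = κ(A)` almost surely. -/
def HasCondLaw {Ω E : Type*} {mΩ : MeasurableSpace Ω} [MeasurableSpace E]
    (Q : Measure Ω) (m : MeasurableSpace Ω) (Y : Ω → E) (κ : Ω → Measure E) : Prop :=
  ∀ A : Set E, MeasurableSet A →
    Q[(Y ⁻¹' A).indicator (fun _ => (1 : ℝ)) | m] =ᵐ[Q] fun ω => (κ ω).real A

/-- Forward price `E^Q[Y | m]` of a nonnegative payoff `Y`. -/
def forwardPrice {Ω : Type*} {mΩ : MeasurableSpace Ω}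
    (Q : Measure Ω) (m : MeasurableSpace Ω) (Y : Ω → ℝ) (ω : Ω) : ℝ :=
  (condLExp m Q (fun ω' => ENNReal.ofReal (Y ω')) ω).toReal

/-! ### The two-fuel market

The fuels are `0` (coal) and `1` (gas). -/

/-- The other fuel. -/
def other (i : Fin 2) : Fin 2 := 1 - i

/-- Constants of the two-fuel market: bid curve parameters `k`, `m` and capacities `cap` of the
fuels; standard deviations `σ` and correlation `ρ` of the log fuel prices; standard deviation `σd`
of the untruncated demand. -/
structure Params where
  k : Fin 2 → ℝ
  m : Fin 2 → ℝ
  cap : Fin 2 → ℝ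
  σ : Fin 2 → ℝ
  ρ : ℝ
  σd : ℝ

namespace Params

variable (p : Params)

/-- Market capacity. -/
def totalCap : ℝ := p.cap 0 + p.cap 1

/-- Bid curve of fuel `i`. -/
def bid (i : Fin 2) (ξ s : ℝ) : ℝ := expBid (p.k i) (p.m i) ξ s

/-- Electricity price at demand `D` and fuel prices `s`. -/
def price (D : ℝ) (s : Fin 2 → ℝ) : ℝ := marketBid p.bid p.cap D s

/-- Demand obtained from `x` by truncation to `[0, totalCap]`. -/
def demand (x : ℝ) : ℝ := max 0 (min p.totalCap x)

def α (i : Fin 2) : ℝ := p.m (other i) / (p.m 0 + p.m 1)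

def β : ℝ := (p.k 0 * p.m 1 + p.k 1 * p.m 0) / (p.m 0 + p.m 1)

def γ : ℝ := p.m 0 * p.m 1 / (p.m 0 + p.m 1)

/-- Bid curve when both fuels are marginal. -/
def bidBoth (ξ : ℝ) (s : Fin 2 → ℝ) : ℝ :=
  s 0 ^ p.α 0 * s 1 ^ p.α 1 * Real.exp (p.β + p.γ * ξ)

/-- Covariance matrix of the log fuel prices. -/
def cov : Matrix (Fin 2) (Fin 2) ℝ :=
  !![p.σ 0 ^ 2, p.ρ * p.σ 0 * p.σ 1; p.ρ * p.σ 0 * p.σ 1, p.σ 1 ^ 2]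

/-- Conditional law of (log fuel prices, untruncated demand): a bivariate Gaussian law with means
`μ` and an independent Gaussian law with mean `μd`. -/
def factorLaw (μ : Fin 2 → ℝ) (μd : ℝ) : Measure (EuclideanSpace ℝ (Fin 2) × ℝ) :=
  (multivariateGaussian (WithLp.toLp 2 μ) p.cov).prod (gaussianReal μd (Real.toNNReal (p.σd ^ 2)))

/-- Variance of the log ratio of the fuel prices. -/
def varRatio : ℝ := p.σ 0 ^ 2 - 2 * p.ρ * p.σ 0 * p.σ 1 + p.σ 1 ^ 2

/-- Standard deviation of the log ratio of the fuel prices. -/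
def sdRatio : ℝ := Real.sqrt p.varRatio

/-- `σ_{i,d}`. -/
def sdDemand (i : Fin 2) : ℝ := Real.sqrt (p.m i ^ 2 * p.σd ^ 2 + p.varRatio)

/-- `R_i^{(n)}(x, y)` at fuel forward prices `F`. -/
def R (n : ℕ) (F : Fin 2 → ℝ) (i : Fin 2) (x y : ℝ) : ℝ :=
  p.k (other i) + p.m (other i) * y - p.k i - p.m i * x + Real.log (F (other i)) - Real.log (F i)
    - ((n : ℝ) - 1 / 2) * p.σ i ^ 2 - 1 / 2 * p.σ (other i) ^ 2
    + n * p.ρ * p.σ i * p.σ (other i)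

/-- `(n² - n) σ_i² / 2`. -/
def ν (n : ℕ) (i : Fin 2) : ℝ := 1 / 2 * ((n : ℝ) ^ 2 - n) * p.σ i ^ 2

def ζ (n : ℕ) (i : Fin 2) : ℝ := p.ν n i + 1 / 2 * (n : ℝ) ^ 2 * p.m i ^ 2 * p.σd ^ 2

def η (n : ℕ) : ℝ :=
  1 / 2 * ((n : ℝ) ^ 2 - n) * (p.α 0 * p.σ 0 ^ 2 + p.α 1 * p.σ 1 ^ 2)
    + (n : ℝ) ^ 2 / 2 * (p.γ ^ 2 * p.σd ^ 2 - p.α 0 * p.α 1 * p.varRatio)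

/-- The sign `δ_i`, where `iplus` is the fuel with the larger capacity. -/
def δ (iplus i : Fin 2) : ℝ := if i = iplus then -1 else 1

/-- Contribution of demand at the lower end of the stack. -/
def lowerEndTerm (n : ℕ) (F : Fin 2 → ℝ) (μd : ℝ) : ℝ :=
  Phi1 (-μd / p.σd) *
    ∑ i, p.bid i 0 (F i) ^ n * Real.exp (p.ν n i) * Phi1 (p.R n F i 0 0 / p.sdRatio)

/-- Contribution of demand at the upper end of the stack. -/
def upperEndTerm (n : ℕ) (F : Fin 2 → ℝ) (μd : ℝ) : ℝ :=
  Phi1 ((μd - p.totalCap) / p.σd) *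
    ∑ i, p.bid i (p.cap i) (F i) ^ n * Real.exp (p.ν n i) *
      Phi1 (-p.R n F i (p.cap i) (p.cap (other i)) / p.sdRatio)

/-- Fuel `i` is marginal and the other fuel is not used. -/
def soleUnusedTerm (n : ℕ) (F : Fin 2 → ℝ) (μd : ℝ) (i : Fin 2) : ℝ :=
  p.bid i μd (F i) ^ n * Real.exp (p.ζ n i) *
    Phi2Diff ((p.cap i - μd) / p.σd - n * p.m i * p.σd) (-μd / p.σd - n * p.m i * p.σd)
      ((p.R n F i μd 0 - n * p.m i ^ 2 * p.σd ^ 2) / p.sdDemand i)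
      (p.m i * p.σd / p.sdDemand i)

/-- Fuel `i` is marginal and the other fuel is exhausted. -/
def soleExhaustedTerm (n : ℕ) (F : Fin 2 → ℝ) (μd : ℝ) (i : Fin 2) : ℝ :=
  p.bid i (μd - p.cap (other i)) (F i) ^ n * Real.exp (p.ζ n i) *
    Phi2Diff ((p.totalCap - μd) / p.σd - n * p.m i * p.σd)
      ((p.cap (other i) - μd) / p.σd - n * p.m i * p.σd)
      ((-p.R n F i (μd - p.cap (other i)) (p.cap (other i)) + n * p.m i ^ 2 * p.σd ^ 2)
        / p.sdDemand i)
      (-p.m i * p.σd / p.sdDemand i)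

/-- Both fuels are marginal: the summand of fuel `i`. -/
def bothTerm (iplus : Fin 2) (n : ℕ) (F : Fin 2 → ℝ) (μd : ℝ) (i : Fin 2) : ℝ :=
  δ iplus i * p.bidBoth μd F ^ n * Real.exp (p.η n) *
    (-Phi2Diff ((p.cap i - μd) / p.σd - n * p.γ * p.σd) (-μd / p.σd - n * p.γ * p.σd)
        ((p.R n F i μd 0 + n * p.α (other i) * p.varRatio - n * p.γ * p.m i * p.σd ^ 2)
          / (δ iplus i * p.sdDemand i))
        (p.m i * p.σd / (δ iplus i * p.sdDemand i))
      + Phi2Diff ((p.totalCap - μd) / p.σd - n * p.γ * p.σd)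
        ((p.cap (other i) - μd) / p.σd - n * p.γ * p.σd)
        ((p.R n F i (μd - p.cap (other i)) (p.cap (other i))
            + n * p.α (other i) * p.varRatio - n * p.γ * p.m i * p.σd ^ 2)
          / (δ iplus i * p.sdDemand i))
        (p.m i * p.σd / (δ iplus i * p.sdDemand i)))

/-- Closed form of the `n`-th conditional moment of the electricity price, as a function of the
fuel forward prices `F` and of the conditional mean `μd` of the untruncated demand. -/
def momentFormula (iplus : Fin 2) (n : ℕ) (F : Fin 2 → ℝ) (μd : ℝ) : ℝ :=
  p.lowerEndTerm n F μd + p.upperEndTerm n F μd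
    + ∑ i, p.soleUnusedTerm n F μd i + ∑ i, p.soleExhaustedTerm n F μd i
    + ∑ i, p.bothTerm iplus n F μd i

end Params

end BidStack

end

noncomputable section

namespace BidStack

/-! ### Price as a market equilibrium -/

section Inverse

variable {b : ℝ → ℝ → ℝ} {cap q s c : ℝ}

/-! The electricity price is a merit-order equilibrium. If the fuels supply quantities adding up to
the demand, no used fuel bids above `P`, no unexhausted fuel bids below `P`, and some used fuel bids
exactly `P`, then the stack returns `P` (`marketBid_eq`). With exponential bids these conditions are
linear in the log fuel prices `u` and the demand `x`. Strictly inside the stack they give five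
regimes: one fuel marginal with the other unused or exhausted (two cases for each fuel), or both
marginal. At the two ends of the stack the cheaper, respectively the dearer, fuel sets the price.

In each regime the price is the exponential of an affine function of `(u, x)`, and the regime is cut
out by a condition on `x` and one on `u i - u j + m i * x`. Away from ties, the `n`-th power of the
price is therefore a signed sum of terms exponential times two half-line indicators
(`price_pow_eq_payoff`). The both-marginal regime is the complement of the other four, which is
where the signs `δ` come from.

The conditional expectation of such a term is computed by an exponential change of measure: tilting
by `exp L` shifts a Gaussian mean by the covariance with `L` and multiplies by the exponential
moment (`integral_exp_mul_comp_prod`). What remains is a product of two half-line probabilities, or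
a difference of two quadrant probabilities of a correlated normal pair
(`prod_gaussianReal_real_quadrant`). Substituting the lognormal forwards `exp (μ i + σ i ^ 2 / 2)`
gives the stated constants (`integralEq_payoff`).

Finally, `HasCondLaw.condLExp_comp` turns integrals against the conditional law into conditional
expectations, and `HasCondLaw.ae_comp` discards the ties, which are null under every `factorLaw`. -/

lemma bddBelow_bidInv (hcap : 0 ≤ cap) :
    BddBelow (insert cap {ξ : ℝ | ξ ∈ Set.Ioc 0 cap ∧ q < b ξ s}) :=
  ⟨0, by rintro ξ (rfl | ⟨h, _⟩); exacts [hcap, h.1.le]⟩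

lemma bidInv_nonneg (hcap : 0 ≤ cap) : 0 ≤ bidInv b cap q s :=
  le_csInf ⟨cap, Set.mem_insert _ _⟩ (by rintro ξ (rfl | ⟨h, _⟩); exacts [hcap, h.1.le])

lemma bidInv_le_cap (hcap : 0 ≤ cap) : bidInv b cap q s ≤ cap :=
  csInf_le (bddBelow_bidInv hcap) (Set.mem_insert _ _)

lemma le_bidInv (hb : Monotone fun ξ => b ξ s) (hc : c ≤ cap) (h : b c s ≤ q) :
    c ≤ bidInv b cap q s := by
  refine le_csInf ⟨cap, Set.mem_insert _ _⟩ ?_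
  rintro ξ (rfl | ⟨_, h2⟩)
  · exact hc
  · by_contra! hlt
    exact absurd (hb hlt.le) (not_le.2 (h.trans_lt h2))

/-- By continuity the bid still exceeds `q` slightly to the left of `c`, so the infimum lies
strictly below `c`. -/
lemma bidInv_lt (hb : Continuous fun ξ => b ξ s) (hc0 : 0 < c) (hc : c ≤ cap) (h : q < b c s) :
    bidInv b cap q s < c := by
  have h1 : ∀ᶠ ξ in nhdsWithin c (Set.Iio c), q < b ξ s :=
    ((hb.tendsto c).mono_left nhdsWithin_le_nhds).eventually_const_lt h
  have h2 : ∀ᶠ ξ in nhdsWithin c (Set.Iio c), ξ ∈ Set.Ioo 0 c := Ioo_mem_nhdsLT hc0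
  obtain ⟨ξ, h3, h4⟩ := (h1.and h2).exists
  exact (csInf_le (bddBelow_bidInv (hc0.le.trans hc))
    (Or.inr ⟨⟨h4.1, h4.2.le.trans hc⟩, h3⟩)).trans_lt h4.2

lemma bidInv_nonpos (hb : Monotone fun ξ => b ξ s) (hcap : 0 ≤ cap) (h : q < b 0 s) :
    bidInv b cap q s ≤ 0 := by
  by_contra! hpos
  have hle := bidInv_le_cap (b := b) (q := q) (s := s) hcap
  -- Every point of `(0, cap]` bids above `q`, so half of a positive infimum would be a smaller
  -- competitor.
  have := csInf_le (bddBelow_bidInv hcap)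
    (show bidInv b cap q s / 2 ∈ insert cap {ξ : ℝ | ξ ∈ Set.Ioc 0 cap ∧ q < b ξ s} from
      Or.inr ⟨⟨by linarith, by linarith⟩, h.trans_le (hb (by linarith))⟩)
  change bidInv b cap q s ≤ _ at this
  linarith

end Inverse

/-- A price at which the fuels supply quantities `c i` in merit order adding up to the demand,
with a marginal fuel, is the market price. -/
theorem marketBid_eq {ι : Type*} [Fintype ι] {b : ι → ℝ → ℝ → ℝ} {cap c s : ι → ℝ} {ξ P : ℝ}
    (hb : ∀ i, Monotone fun ξ => b i ξ (s i)) (hb' : ∀ i, Continuous fun ξ => b i ξ (s i))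
    (hc : ∀ i, c i ∈ Set.Icc 0 (cap i)) (hsum : ∑ i, c i = ξ)
    (h1 : ∀ i, c i = 0 ∨ b i (c i) (s i) ≤ P)
    (h2 : ∀ i, c i = cap i ∨ P ≤ b i (c i) (s i))
    (h3 : ∃ i, 0 < c i ∧ P ≤ b i (c i) (s i)) :
    marketBid b cap ξ s = P := by
  have hcap : ∀ i, 0 ≤ cap i := fun i => (hc i).1.trans (hc i).2
  -- Below `P` no fuel offers more than `c i`, and the marginal fuel of `h3` offers strictly less.
  -- Without it the set could stop short of `P` when the demand exactly exhausts a fuel.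
  have hlt : ∀ q < P, ∑ i, bidInv (b i) (cap i) q (s i) < ξ := by
    intro q hq
    rw [← hsum]
    have hle : ∀ i, bidInv (b i) (cap i) q (s i) ≤ c i := by
      intro i
      rcases h2 i with h | h
      · exact (bidInv_le_cap (hcap i)).trans_eq h.symm
      · rcases (hc i).1.eq_or_lt with h0 | h0
        · rw [← h0] at h ⊢
          exact bidInv_nonpos (hb i) (hcap i) (hq.trans_le h)
        · exact (bidInv_lt (hb' i) h0 (hc i).2 (hq.trans_le h)).le
    obtain ⟨i, hi0, hi⟩ := h3
    exact Finset.sum_lt_sum (fun i _ => hle i)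
      ⟨i, Finset.mem_univ _, bidInv_lt (hb' i) hi0 (hc i).2 (hq.trans_le hi)⟩
  have hge : ∀ q, P ≤ q → ξ ≤ ∑ i, bidInv (b i) (cap i) q (s i) := by
    intro q hq
    rw [← hsum]
    refine Finset.sum_le_sum fun i _ => ?_
    rcases h1 i with h | h
    · exact h ▸ bidInv_nonneg (hcap i)
    · exact le_bidInv (hb i) (hc i).2 (h.trans hq)
  have hmin : ⨅ i, b i 0 (s i) ≤ P := by
    obtain ⟨i, hi0, hi⟩ := h3
    refine (ciInf_le (Set.finite_range _).bddBelow i).trans ((hb i hi0.le).trans ?_)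
    exact (h1 i).resolve_left hi0.ne'
  refine IsLUB.csSup_eq ⟨?_, fun w hw => ?_⟩ ⟨_, Set.mem_insert _ _⟩
  · rintro q (rfl | hq)
    · exact hmin
    · by_contra! h
      exact absurd (hge q h.le) (not_le.2 hq)
  · exact le_of_forall_lt fun q hq => by
      obtain ⟨q', h, h'⟩ := exists_between hq
      exact h.trans_le (hw (Or.inr (hlt q' h')))

theorem marketBid_zero {ι : Type*} [Fintype ι] {b : ι → ℝ → ℝ → ℝ} {cap s : ι → ℝ}
    (hcap : ∀ i, 0 ≤ cap i) : marketBid b cap 0 s = ⨅ i, b i 0 (s i) := by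
  have : {p : ℝ | ∑ i, bidInv (b i) (cap i) p (s i) < 0} = ∅ := by
    ext q
    simpa using Finset.sum_nonneg fun i _ => bidInv_nonneg (hcap i)
  simp [marketBid, this]

/-! ### Regimes of the two-fuel market -/

lemma sum_fin_two_eq {M : Type*} [AddCommMonoid M] (f : Fin 2 → M) (i : Fin 2) :
    ∑ j, f j = f i + f (other i) := by
  fin_cases i <;> simp [other, Fin.sum_univ_two, add_comm]

lemma other_other (i : Fin 2) : other (other i) = i := by fin_cases i <;> rfl

lemma eq_or_eq_other (i j : Fin 2) : j = i ∨ j = other i := by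
  fin_cases i <;> fin_cases j <;> simp [other]

lemma other_ne (i : Fin 2) : other i ≠ i := by fin_cases i <;> simp [other]

namespace Params

variable {p : Params}

lemma totalCap_eq (i : Fin 2) : p.totalCap = p.cap i + p.cap (other i) := by
  rw [← sum_fin_two_eq p.cap i, Fin.sum_univ_two, totalCap]

lemma bid_exp (i : Fin 2) (ξ u : ℝ) :
    p.bid i ξ (Real.exp u) = Real.exp (u + p.k i + p.m i * ξ) := by
  rw [bid, expBid, ← Real.exp_add]; ring_nf

lemma bidBoth_exp (i : Fin 2) (ξ : ℝ) (u : Fin 2 → ℝ) :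
    p.bidBoth ξ (fun j => Real.exp (u j)) =
      Real.exp (p.α i * u i + p.α (other i) * u (other i) + (p.β + p.γ * ξ)) := by
  have : p.α i * u i + p.α (other i) * u (other i) = p.α 0 * u 0 + p.α 1 * u 1 := by
    rw [← sum_fin_two_eq (fun j => p.α j * u j) i, Fin.sum_univ_two]
  rw [this, bidBoth, ← Real.exp_mul, ← Real.exp_mul, ← Real.exp_add, ← Real.exp_add]
  ring_nf

/-- The equilibrium criterion in logarithmic form, where all its conditions become linear. -/
lemma price_eq (hm : ∀ i, 0 < p.m i) {u c : Fin 2 → ℝ} {L : ℝ} (i : Fin 2)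
    (hc : ∀ i, c i ∈ Set.Icc 0 (p.cap i))
    (h1 : ∀ i, c i = 0 ∨ u i + p.k i + p.m i * c i ≤ L)
    (h2 : ∀ i, c i = p.cap i ∨ L ≤ u i + p.k i + p.m i * c i)
    (h3 : ∃ i, 0 < c i ∧ L ≤ u i + p.k i + p.m i * c i) :
    p.price (c i + c (other i)) (fun i => Real.exp (u i)) = Real.exp L := by
  refine marketBid_eq (c := c) (fun j x y hxy => ?_) (fun j => ?_) hc (sum_fin_two_eq c i) ?_ ?_ ?_
  · simp only [bid_exp, Real.exp_le_exp]
    have := mul_le_mul_of_nonneg_left hxy (hm j).le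
    linarith
  · simp only [bid_exp]
    fun_prop
  all_goals simpa only [bid_exp, Real.exp_le_exp]

lemma price_sole_unused (hm : ∀ i, 0 < p.m i) (hcap : ∀ i, 0 < p.cap i)
    {u : Fin 2 → ℝ} {x : ℝ} (i : Fin 2) (hx : 0 < x) (hxc : x ≤ p.cap i)
    (h : u i + p.k i + p.m i * x ≤ u (other i) + p.k (other i)) :
    p.price x (fun i => Real.exp (u i)) = p.bid i x (Real.exp (u i)) := by
  have := price_eq hm (u := u) (c := fun j => if j = i then x else 0)
    (L := u i + p.k i + p.m i * x) i (fun j => ?_) (fun j => ?_) (fun j => ?_) ⟨i, by simpa⟩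
  · simpa [other_ne, bid_exp] using this
  all_goals rcases eq_or_eq_other i j with rfl | rfl
  all_goals simp [other_ne, hx.le, hxc, (hcap _).le, h]

/-- The competitor runs at capacity and fuel `i` covers the rest; the strict inequality `hx` makes
that rest positive, so that `i` is marginal. -/
lemma price_sole_exhausted (hm : ∀ i, 0 < p.m i) (hcap : ∀ i, 0 < p.cap i)
    {u : Fin 2 → ℝ} {x : ℝ} (i : Fin 2) (hx : p.cap (other i) < x) (hxc : x ≤ p.totalCap)
    (h : u (other i) + p.k (other i) + p.m (other i) * p.cap (other i)
      ≤ u i + p.k i + p.m i * (x - p.cap (other i))) :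
    p.price x (fun i => Real.exp (u i)) = p.bid i (x - p.cap (other i)) (Real.exp (u i)) := by
  rw [totalCap_eq i] at hxc
  have := price_eq hm (u := u)
    (c := fun j => if j = i then x - p.cap (other i) else p.cap (other i))
    (L := u i + p.k i + p.m i * (x - p.cap (other i))) i (fun j => ?_) (fun j => ?_) (fun j => ?_)
    ⟨i, by simpa⟩
  · simpa [other_ne, bid_exp] using this
  all_goals rcases eq_or_eq_other i j with rfl | rfl
  all_goals simp [other_ne, hx.le, (hcap _).le, h]
  linarith

lemma price_zero (hcap : ∀ i, 0 < p.cap i) {u : Fin 2 → ℝ} (i : Fin 2)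
    (h : u i + p.k i ≤ u (other i) + p.k (other i)) :
    p.price 0 (fun i => Real.exp (u i)) = p.bid i 0 (Real.exp (u i)) := by
  rw [price, marketBid_zero fun i => (hcap i).le]
  refine IsGLB.ciInf_eq ⟨?_, fun w hw => hw ⟨i, rfl⟩⟩
  rintro _ ⟨j, rfl⟩
  rcases eq_or_eq_other i j with rfl | rfl <;> simp [bid_exp, h]

/-- The split of the demand that equalises the two log bids is feasible exactly because no sole
regime holds strictly: `hA` and `hB` keep both quantities between zero and capacity. The common log
bid is the one in `bidBoth`. -/
lemma price_both (hm : ∀ i, 0 < p.m i) {u : Fin 2 → ℝ} {x : ℝ} (hx : 0 < x)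
    (hA : ∀ i, x ≤ p.cap i → u (other i) + p.k (other i) ≤ u i + p.k i + p.m i * x)
    (hB : ∀ i, p.cap (other i) < x → u i + p.k i + p.m i * (x - p.cap (other i))
      ≤ u (other i) + p.k (other i) + p.m (other i) * p.cap (other i)) :
    p.price x (fun i => Real.exp (u i)) = p.bidBoth x (fun i => Real.exp (u i)) := by
  -- Solution of `u i + k i + m i * c i = u j + k j + m j * (x - c i)`, with `j` the other fuel.
  set c : Fin 2 → ℝ := fun i =>
    (u (other i) + p.k (other i) - u i - p.k i + p.m (other i) * x) / (p.m i + p.m (other i))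
    with hcdef
  have hM : ∀ i, 0 < p.m i + p.m (other i) := fun i => add_pos (hm i) (hm _)
  have hsum : ∀ i, c i + c (other i) = x := by
    intro i
    have := (hM i).ne'
    simp only [hcdef, other_other]
    rw [add_comm (p.m (other i)), ← add_div, div_eq_iff this]
    ring
  have hL : ∀ i, u i + p.k i + p.m i * c i =
      p.α 0 * u 0 + p.α (other 0) * u (other 0) + (p.β + p.γ * x) := by
    have := (hM 0).ne'
    intro i
    fin_cases i <;> simp [hcdef, other, α, β, γ] at this ⊢
    · field_simp
      ring
    · rw [add_comm (p.m 1)]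
      field_simp
      ring
  have hc : ∀ i, c i ∈ Set.Icc 0 (p.cap i) := by
    intro i
    have hA' := hA (other i)
    have hB' := hB (other i)
    rw [other_other] at hA' hB'
    constructor
    · refine div_nonneg ?_ (hM i).le
      rcases le_or_gt x (p.cap (other i)) with h | h
      · linarith [hA' h]
      · nlinarith [hB i h, mul_pos (hm i) (sub_pos.2 h), mul_pos (hm (other i)) (sub_pos.2 h)]
    · rw [div_le_iff₀ (hM i)]
      rcases le_or_gt x (p.cap i) with h | h
      · nlinarith [hA i h, mul_nonneg (hm i).le (sub_nonneg.2 h),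
          mul_nonneg (hm (other i)).le (sub_nonneg.2 h)]
      · linarith [hB' h]
  have h3 : ∃ i, 0 < c i := by
    by_contra! h
    linarith [h 0, h (other 0), hsum 0]
  obtain ⟨i, hi⟩ := h3
  rw [bidBoth_exp 0, ← hsum 0]
  refine price_eq hm 0 hc (fun i => .inr ?_) (fun i => .inr ?_) ⟨i, hi, ?_⟩
  all_goals rw [hsum 0, hL]

lemma price_totalCap (hm : ∀ i, 0 < p.m i) (hcap : ∀ i, 0 < p.cap i) {u : Fin 2 → ℝ} (i : Fin 2)
    (h : u (other i) + p.k (other i) + p.m (other i) * p.cap (other i)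
      ≤ u i + p.k i + p.m i * p.cap i) :
    p.price p.totalCap (fun i => Real.exp (u i)) = p.bid i (p.cap i) (Real.exp (u i)) := by
  rw [price_sole_exhausted hm hcap i (by linarith [totalCap_eq (p := p) i, hcap i]) le_rfl,
    totalCap_eq i, add_sub_cancel_right]
  rwa [totalCap_eq i, add_sub_cancel_right]

lemma demand_of_nonpos {x : ℝ} (h : x ≤ 0) : p.demand x = 0 :=
  max_eq_left ((min_le_right _ _).trans h)

lemma demand_of_mem {x : ℝ} (h : 0 ≤ x) (h' : x ≤ p.totalCap) : p.demand x = x := by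
  rw [demand, min_eq_right h', max_eq_right h]

lemma demand_of_ge (hcap : ∀ i, 0 < p.cap i) {x : ℝ} (h : p.totalCap ≤ x) :
    p.demand x = p.totalCap := by
  have h0 : 0 ≤ p.totalCap := (add_pos (hcap 0) (hcap 1)).le
  rw [demand, min_eq_left h, max_eq_right h0]

lemma price_demand_pos (hm : ∀ i, 0 < p.m i) (hcap : ∀ i, 0 < p.cap i) (u : Fin 2 → ℝ) (x : ℝ) :
    0 < p.price (p.demand x) (fun i => Real.exp (u i)) := by
  have hbid : ∀ i ξ, 0 < p.bid i ξ (Real.exp (u i)) := fun i ξ => by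
    rw [bid_exp]; exact Real.exp_pos _
  rcases le_or_gt x 0 with h0 | h0
  · rw [demand_of_nonpos h0]
    rcases le_total (u 0 + p.k 0) (u 1 + p.k 1) with h | h
    · rw [price_zero hcap 0 h]; apply hbid
    · rw [price_zero hcap 1 h]; apply hbid
  rcases le_or_gt p.totalCap x with h1 | h1
  · rw [demand_of_ge hcap h1]
    rcases le_total (u 0 + p.k 0 + p.m 0 * p.cap 0) (u 1 + p.k 1 + p.m 1 * p.cap 1) with h | h
    · rw [price_totalCap hm hcap 1 h]; apply hbid
    · rw [price_totalCap hm hcap 0 h]; apply hbid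
  rw [demand_of_mem h0.le h1.le]
  by_cases hA : ∀ i, x ≤ p.cap i → u (other i) + p.k (other i) ≤ u i + p.k i + p.m i * x
  · by_cases hB : ∀ i, p.cap (other i) < x → u i + p.k i + p.m i * (x - p.cap (other i))
      ≤ u (other i) + p.k (other i) + p.m (other i) * p.cap (other i)
    · rw [price_both hm h0 hA hB, bidBoth_exp 0]
      exact Real.exp_pos _
    · push Not at hB
      obtain ⟨i, hi, h⟩ := hB
      rw [price_sole_exhausted hm hcap i hi h1.le h.le]
      apply hbid
  · push Not at hA
    obtain ⟨i, hi, h⟩ := hA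
    rw [price_sole_unused hm hcap i h0 hi h.le]
    apply hbid

/-! ### Decomposition of the price power into indicators -/

/-- Indicator of `a ≤ b`. -/
def leInd (a b : ℝ) : ℝ := if a ≤ b then 1 else 0

lemma leInd_of_le {a b : ℝ} (h : a ≤ b) : leInd a b = 1 := if_pos h

lemma leInd_of_lt {a b : ℝ} (h : b < a) : leInd a b = 0 := if_neg (not_le.2 h)

lemma leInd_mul_sign {ε a b : ℝ} (hε : ε = 1 ∨ ε = -1) (h : a ≠ b) :
    ε * leInd (ε * a) (ε * b) = leInd a b - (1 - ε) / 2 := by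
  rcases hε with rfl | rfl
  · simp
  · rcases h.lt_or_gt with h | h
    · rw [leInd_of_le h.le, leInd_of_lt (by linarith)]; norm_num
    · rw [leInd_of_lt h, leInd_of_le (by linarith)]; norm_num

lemma leInd_neg {a b : ℝ} (h : a ≠ b) : leInd (-a) (-b) = 1 - leInd a b := by
  have := leInd_mul_sign (.inr rfl) h
  simp only [neg_mul, one_mul] at this
  linarith

/-- Log price ratio threshold below which fuel `i` at its quantity `x` is cheaper than the other
fuel at its quantity `y`. -/
def threshold (p : Params) (i : Fin 2) (x y : ℝ) : ℝ :=
  p.k (other i) + p.m (other i) * y - p.k i - p.m i * x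

/-- The `n`-th power of the price strictly inside the stack. -/
lemma price_pow_inside (hm : ∀ i, 0 < p.m i) (hcap : ∀ i, 0 < p.cap i) (n : ℕ) (i : Fin 2)
    {u : Fin 2 → ℝ} {x : ℝ} (h0 : 0 < x) (h1 : x < p.totalCap) {A B : Fin 2 → ℝ}
    (hA : ∀ i, A i = leInd x (p.cap i) *
      leInd (u i - u (other i) + p.m i * x) (p.threshold i 0 0))
    (hB : ∀ i, B i = (1 - leInd x (p.cap (other i))) *
      leInd (-(u i - u (other i) + p.m i * x))
        (-p.threshold i (-p.cap (other i)) (p.cap (other i)))) :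
    p.price x (fun i => Real.exp (u i)) ^ n =
      p.bid i x (Real.exp (u i)) ^ n * A i
      + p.bid (other i) x (Real.exp (u (other i))) ^ n * A (other i)
      + p.bid i (x - p.cap (other i)) (Real.exp (u i)) ^ n * B i
      + p.bid (other i) (x - p.cap i) (Real.exp (u (other i))) ^ n * B (other i)
      + p.bidBoth x (fun i => Real.exp (u i)) ^ n *
        (1 - A i - A (other i) - B i - B (other i)) := by
  -- The sole regimes exclude one another because `x` is strictly between zero and the market
  -- capacity; the both-marginal regime is the remainder.
  have hA1 : ∀ i, x ≤ p.cap i → u i + p.k i + p.m i * x ≤ u (other i) + p.k (other i) →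
      A i = 1 ∧ A (other i) = 0 ∧ B i = 0 ∧ B (other i) = 0 := by
    intro i h h'
    have hmx := mul_pos (hm i) h0
    have hmx' := mul_pos (hm (other i)) h0
    refine ⟨?_, ?_, ?_, ?_⟩
    · rw [hA, leInd_of_le h, leInd_of_le (by rw [threshold]; linarith), one_mul]
    · rw [hA, leInd_of_lt (a := u _ - _ + _) (by rw [threshold, other_other]; linarith), mul_zero]
    · rw [hB, leInd_of_lt (a := -(u _ - _ + _)), mul_zero]
      rw [threshold]
      have := mul_pos (hm i) (hcap (other i))
      have := mul_pos (hm (other i)) (hcap (other i))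
      linarith
    · rw [hB, other_other, leInd_of_le h, sub_self, zero_mul]
  have hB1 : ∀ i, p.cap (other i) < x →
      u (other i) + p.k (other i) + p.m (other i) * p.cap (other i)
        ≤ u i + p.k i + p.m i * (x - p.cap (other i)) →
      A i = 0 ∧ A (other i) = 0 ∧ B i = 1 ∧ B (other i) = 0 := by
    intro i h h'
    have := mul_pos (hm i) (hcap (other i))
    have := mul_pos (hm (other i)) (hcap (other i))
    refine ⟨?_, ?_, ?_, ?_⟩
    · rw [hA, leInd_of_lt (a := u _ - _ + _) (by rw [threshold]; linarith), mul_zero]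
    · rw [hA, leInd_of_lt h, zero_mul]
    · rw [hB, leInd_of_lt h, leInd_of_le (by rw [threshold]; linarith)]
      norm_num
    · rw [hB, leInd_of_lt (a := -(u _ - _ + _)), mul_zero]
      rw [threshold, other_other]
      rw [totalCap_eq i] at h1
      have := mul_pos (hm i) (sub_pos.2 h1)
      have := mul_pos (hm (other i)) (sub_pos.2 h1)
      linarith
  by_cases hA' : ∀ i, x ≤ p.cap i → u (other i) + p.k (other i) < u i + p.k i + p.m i * x
  · by_cases hB' : ∀ i, p.cap (other i) < x → u i + p.k i + p.m i * (x - p.cap (other i))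
      < u (other i) + p.k (other i) + p.m (other i) * p.cap (other i)
    · rw [price_both hm h0 (fun i h => (hA' i h).le) (fun i h => (hB' i h).le)]
      have hA0 : ∀ i, A i = 0 := by
        intro i
        rw [hA]
        rcases le_or_gt x (p.cap i) with h | h
        · rw [leInd_of_lt (a := u _ - _ + _), mul_zero]
          rw [threshold]
          linarith [hA' i h]
        · rw [leInd_of_lt h, zero_mul]
      have hB0 : ∀ i, B i = 0 := by
        intro i
        rw [hB]
        rcases le_or_gt x (p.cap (other i)) with h | h
        · rw [leInd_of_le h, sub_self, zero_mul]
        · rw [leInd_of_lt (a := -(u _ - _ + _)), mul_zero]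
          rw [threshold]
          linarith [hB' i h]
      simp [hA0, hB0]
    · push Not at hB'
      obtain ⟨l, hl, h⟩ := hB'
      rw [price_sole_exhausted hm hcap l hl h1.le h]
      obtain ⟨e1, e2, e3, e4⟩ := hB1 l hl h
      rcases eq_or_eq_other i l with rfl | rfl
      · simp [e1, e2, e3, e4]
      · simp only [other_other] at e2 e4 ⊢
        simp [e1, e2, e3, e4]
  · push Not at hA'
    obtain ⟨l, hl, h⟩ := hA'
    rw [price_sole_unused hm hcap l h0 hl h]
    obtain ⟨e1, e2, e3, e4⟩ := hA1 l hl h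
    rcases eq_or_eq_other i l with rfl | rfl
    · simp [e1, e2, e3, e4]
    · simp only [other_other] at e2 e4 ⊢
      simp [e1, e2, e3, e4]

/-- The `n`-th power of the electricity price as a function of the log fuel prices `u` and the
untruncated demand `x`, decomposed according to the marginal fuels. -/
def payoff (p : Params) (iplus : Fin 2) (n : ℕ) (u : Fin 2 → ℝ) (x : ℝ) : ℝ :=
  (∑ i, leInd x 0 * leInd (u i - u (other i)) (p.threshold i 0 0)
      * p.bid i 0 (Real.exp (u i)) ^ n)
  + (∑ i, leInd (-x) (-p.totalCap)
      * leInd (-(u i - u (other i))) (-p.threshold i (p.cap i) (p.cap (other i)))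
      * p.bid i (p.cap i) (Real.exp (u i)) ^ n)
  + (∑ i, (leInd x (p.cap i) - leInd x 0)
      * leInd (u i - u (other i) + p.m i * x) (p.threshold i 0 0)
      * p.bid i x (Real.exp (u i)) ^ n)
  + (∑ i, (leInd x p.totalCap - leInd x (p.cap (other i)))
      * leInd (-(u i - u (other i) + p.m i * x))
          (-p.threshold i (-p.cap (other i)) (p.cap (other i)))
      * p.bid i (x - p.cap (other i)) (Real.exp (u i)) ^ n)
  + ∑ i, δ iplus i *
      (-((leInd x (p.cap i) - leInd x 0)
        * leInd (δ iplus i * (u i - u (other i) + p.m i * x)) (δ iplus i * p.threshold i 0 0))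
      + (leInd x p.totalCap - leInd x (p.cap (other i)))
        * leInd (δ iplus i * (u i - u (other i) + p.m i * x))
          (δ iplus i * p.threshold i (-p.cap (other i)) (p.cap (other i))))
      * p.bidBoth x (fun i => Real.exp (u i)) ^ n

lemma δ_eq (iplus i : Fin 2) : δ iplus i = 1 ∨ δ iplus i = -1 := by
  rw [δ]; split_ifs <;> simp

/-- The excluded values are those where closed indicators overlap: at `x = totalCap` the interior
and the upper end would both be counted, and at equal bids an indicator and its reflection are both
one. -/
theorem price_pow_eq_payoff (hm : ∀ i, 0 < p.m i) (hcap : ∀ i, 0 < p.cap i) (iplus : Fin 2) (n : ℕ)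
    {u : Fin 2 → ℝ} {x : ℝ} (hx : x ≠ p.totalCap)
    (h0 : ∀ i, u i - u (other i) ≠ p.threshold i 0 0)
    (hc : ∀ i, u i - u (other i) ≠ p.threshold i (p.cap i) (p.cap (other i)))
    (hA : ∀ i, u i - u (other i) + p.m i * x ≠ p.threshold i 0 0)
    (hB : ∀ i, u i - u (other i) + p.m i * x ≠
      p.threshold i (-p.cap (other i)) (p.cap (other i))) :
    p.price (p.demand x) (fun i => Real.exp (u i)) ^ n = p.payoff iplus n u x := by
  have hsum := fun f : Fin 2 → ℝ => sum_fin_two_eq f iplus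
  have ht := totalCap_eq (p := p)
  rcases le_or_gt x 0 with hx0 | hx0
  · have e1 : ∀ i, leInd x (p.cap i) = 1 := fun i => leInd_of_le (hx0.trans (hcap i).le)
    have e2 : leInd x p.totalCap = 1 := leInd_of_le (by linarith [ht 0, hcap 0, hcap (other 0)])
    have e3 : leInd (-x) (-p.totalCap) = 0 :=
      leInd_of_lt (by linarith [ht 0, hcap 0, hcap (other 0)])
    have key : ∀ i, u i + p.k i ≤ u (other i) + p.k (other i) →
        p.price 0 (fun i => Real.exp (u i)) ^ n =
          leInd (u i - u (other i)) (p.threshold i 0 0) * p.bid i 0 (Real.exp (u i)) ^ n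
          + leInd (u (other i) - u i) (p.threshold (other i) 0 0)
            * p.bid (other i) 0 (Real.exp (u (other i))) ^ n := by
      intro i h
      have h0' := h0 i
      rw [price_zero hcap i h, leInd_of_le (a := u i - _), leInd_of_lt (a := u (other i) - _)]
      · ring
      · rw [threshold, other_other]
        have : u i - u (other i) ≠ p.k (other i) - p.k i := fun h => h0' (by rw [threshold, h]; ring)
        have : u i - u (other i) < p.k (other i) - p.k i := lt_of_le_of_ne (by linarith) this
        linarith
      · rw [threshold]; linarith
    rw [demand_of_nonpos hx0, payoff]
    simp only [e1, e2, e3, leInd_of_le hx0, sub_self, hsum, other_other]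
    rcases le_total (u iplus + p.k iplus) (u (other iplus) + p.k (other iplus)) with h | h
    · rw [key iplus h]; ring
    · have := key (other iplus) (by rwa [other_other])
      rw [other_other] at this
      rw [this]; ring
  have e0 : leInd x 0 = 0 := leInd_of_lt hx0
  rcases lt_or_gt_of_ne hx with hx1 | hx1
  · rw [demand_of_mem hx0.le hx1.le, payoff,
      price_pow_inside hm hcap n iplus hx0 hx1 (fun _ => rfl) (fun _ => rfl)]
    have e1 : leInd (-x) (-p.totalCap) = 0 := leInd_of_lt (by linarith)
    have e2 : leInd x p.totalCap = 1 := leInd_of_le hx1.le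
    have d1 : δ iplus iplus = -1 := if_pos rfl
    have d2 : δ iplus (other iplus) = 1 := if_neg (other_ne _)
    simp only [hsum, e0, e1, e2, d1, d2, other_other, neg_mul, one_mul]
    -- Reflecting an indicator replaces it by one minus itself. For sign `-1` this leaves `leInd x
    -- (cap iplus)`, and the summand of the other fuel leaves `1 - leInd x (cap iplus)`. Together
    -- they supply the `1` from which the four sole indicators are subtracted.
    have a1 := leInd_neg (hA iplus)
    have b1 := leInd_neg (hB iplus)
    have b2 := leInd_neg (hB (other iplus))
    simp only [other_other] at b2
    rw [a1, b1, b2]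
    ring
  · have e1 : ∀ i, leInd x (p.cap i) = 0 := fun i =>
      leInd_of_lt (by linarith [ht i, hcap i, hcap (other i)])
    have e2 : leInd x p.totalCap = 0 := leInd_of_lt hx1
    have e3 : leInd (-x) (-p.totalCap) = 1 := leInd_of_le (by linarith)
    have key : ∀ i, u (other i) + p.k (other i) + p.m (other i) * p.cap (other i)
          ≤ u i + p.k i + p.m i * p.cap i →
        p.price p.totalCap (fun i => Real.exp (u i)) ^ n =
          leInd (-(u i - u (other i))) (-p.threshold i (p.cap i) (p.cap (other i)))
            * p.bid i (p.cap i) (Real.exp (u i)) ^ n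
          + leInd (-(u (other i) - u i)) (-p.threshold (other i) (p.cap (other i)) (p.cap i))
            * p.bid (other i) (p.cap (other i)) (Real.exp (u (other i))) ^ n := by
      intro i h
      have hc' := hc i
      rw [threshold] at hc'
      rw [price_totalCap hm hcap i h, leInd_of_le (a := -(u i - _)),
        leInd_of_lt (a := -(u (other i) - _))]
      · ring
      · rw [threshold, other_other]
        have := lt_of_le_of_ne (by linarith) hc'.symm
        linarith
      · rw [threshold]; linarith
    rw [demand_of_ge hcap hx1.le, payoff]
    simp only [e0, e1, e2, e3, sub_self, hsum, other_other]
    rcases le_total (u (other iplus) + p.k (other iplus) + p.m (other iplus) * p.cap (other iplus))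
      (u iplus + p.k iplus + p.m iplus * p.cap iplus) with h | h
    · rw [key iplus h]; ring
    · have := key (other iplus) (by rwa [other_other])
      rw [other_other] at this
      rw [this]; ring

end Params

/-! ### Exponential change of measure for Gaussian laws -/

/-- Completing the square in the density. -/
lemma integral_exp_mul_gaussianReal {m q : ℝ} {v : ℝ≥0} (hv : v ≠ 0) (g : ℝ → ℝ) :
    ∫ x, Real.exp (q * x) * g x ∂(gaussianReal m v) =
      Real.exp (q * m + q ^ 2 * v / 2) * ∫ x, g x ∂(gaussianReal (m + q * v) v) := by
  rw [integral_gaussianReal_eq_integral_smul hv, integral_gaussianReal_eq_integral_smul hv,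
    ← integral_const_mul]
  congr with x
  have hv' : (v : ℝ) ≠ 0 := by simpa
  simp only [gaussianPDFReal, smul_eq_mul]
  have : Real.exp (-(x - m) ^ 2 / (2 * v)) * Real.exp (q * x) =
      Real.exp (q * m + q ^ 2 * v / 2) * Real.exp (-(x - (m + q * v)) ^ 2 / (2 * v)) := by
    rw [← Real.exp_add, ← Real.exp_add]
    congr 1
    field_simp
    ring
  linear_combination (√(2 * Real.pi * v))⁻¹ * g x * this

section Tilt

variable {Ω : Type*} {mΩ : MeasurableSpace Ω} {ν : Measure Ω}

lemma integral_exp_of_hasGaussianLaw {L : Ω → ℝ} (h : HasGaussianLaw L ν) :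
    ∫ ω, Real.exp (L ω) ∂ν = Real.exp (ν[L] + Var[L; ν] / 2) := by
  have := mgf_gaussianReal h.map_eq_gaussianReal 1
  simpa [mgf, variance_nonneg] using this

lemma integrable_exp_of_hasGaussianLaw {L : Ω → ℝ} (h : HasGaussianLaw L ν) :
    Integrable (fun ω => Real.exp (L ω)) ν := by
  have hν := h.isProbabilityMeasure
  -- A non-integrable function has integral zero by convention, so a nonzero value proves
  -- integrability.
  refine Integrable.of_integral_ne_zero ?_
  rw [integral_exp_of_hasGaussianLaw h]
  exact (Real.exp_pos _).ne'

/-- Regress `L` on `V`: the residual is uncorrelated with `V`, hence independent of it, and only a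
one-dimensional tilt of `V` remains. No joint density is used, so zero volatilities and correlation
`±1` are covered. -/
theorem integral_exp_mul_comp {L V : Ω → ℝ} (h : HasGaussianLaw (fun ω => (L ω, V ω)) ν)
    (hV : Var[V; ν] ≠ 0) {g : ℝ → ℝ} (hg : Measurable g) :
    ∫ ω, Real.exp (L ω) * g (V ω) ∂ν = Real.exp (ν[L] + Var[L; ν] / 2) *
      ∫ v, g v ∂(gaussianReal (ν[V] + cov[L, V; ν]) Var[V; ν].toNNReal) := by
  have hν := h.isProbabilityMeasure
  set q := cov[L, V; ν] / Var[V; ν] with hq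
  have hqV : q * Var[V; ν] = cov[L, V; ν] := div_mul_cancel₀ _ hV
  have hL2 := h.fst.memLp_two
  have hV2 := h.snd.memLp_two
  have hqV2 : MemLp (fun ω => q * V ω) 2 ν := hV2.const_mul q
  have hEV : HasGaussianLaw (fun ω => (L ω - q * V ω, V ω)) ν :=
    h.map_fun (((ContinuousLinearMap.fst ℝ ℝ ℝ) - q • (ContinuousLinearMap.snd ℝ ℝ ℝ)).prod
      (ContinuousLinearMap.snd ℝ ℝ ℝ))
  have hcov : cov[fun ω => L ω - q * V ω, V; ν] = 0 := by
    rw [covariance_fun_sub_left hL2 hqV2 hV2, covariance_const_mul_left,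
      covariance_self hV2.aemeasurable, hqV, sub_self]
  have hind := hEV.indepFun_of_covariance_eq_zero hcov
  have hvar : Var[fun ω => L ω - q * V ω; ν] = Var[L; ν] - q ^ 2 * Var[V; ν] := by
    rw [variance_fun_sub hL2 hqV2, variance_const_mul, covariance_const_mul_right, ← hqV]
    ring
  have hmean : ∫ ω, (L ω - q * V ω) ∂ν = ν[L] - q * ν[V] := by
    rw [integral_sub h.fst.integrable (h.snd.integrable.const_mul q), integral_const_mul]
  have hind' : IndepFun (fun ω => Real.exp (L ω - q * V ω))
      (fun ω => Real.exp (q * V ω) * g (V ω)) ν :=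
    hind.comp (φ := Real.exp) (ψ := fun v => Real.exp (q * v) * g v) Real.measurable_exp
      (by fun_prop)
  have hV' : (Var[V; ν].toNNReal : ℝ) = Var[V; ν] := Real.coe_toNNReal _ (variance_nonneg _ _)
  calc ∫ ω, Real.exp (L ω) * g (V ω) ∂ν
      = ∫ ω, Real.exp (L ω - q * V ω) * (Real.exp (q * V ω) * g (V ω)) ∂ν := by
        congr with ω
        rw [← mul_assoc, ← Real.exp_add, sub_add_cancel]
    _ = (∫ ω, Real.exp (L ω - q * V ω) ∂ν) * ∫ ω, Real.exp (q * V ω) * g (V ω) ∂ν := by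
        have hVm := h.snd.aemeasurable
        refine hind'.integral_fun_mul_eq_mul_integral ?_ ?_
        · exact (Real.measurable_exp.comp_aemeasurable hEV.fst.aemeasurable).aestronglyMeasurable
        · exact ((show Measurable fun v => Real.exp (q * v) * g v by fun_prop).comp_aemeasurable
            hVm).aestronglyMeasurable
    _ = _ := by
        have : ∫ ω, Real.exp (q * V ω) * g (V ω) ∂ν =
            ∫ v, Real.exp (q * v) * g v ∂(ν.map V) := by
          rw [integral_map h.snd.aemeasurable]
          exact (show Measurable fun v => Real.exp (q * v) * g v by fun_prop).aestronglyMeasurable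
        rw [integral_exp_of_hasGaussianLaw hEV.fst, this, h.snd.map_eq_gaussianReal,
          integral_exp_mul_gaussianReal, hV', hqV, ← mul_assoc, ← Real.exp_add, hmean, hvar]
        · congr 2
          ring
        · simpa using lt_of_le_of_ne (variance_nonneg V ν) hV.symm

/-- Joint exponential change of measure for a Gaussian pair and an independent Gaussian variable. -/
theorem integral_exp_mul_comp_prod {L V : Ω → ℝ} (h : HasGaussianLaw (fun ω => (L ω, V ω)) ν)
    (hVm : Measurable V)
    (hV : Var[V; ν] ≠ 0) (c b : ℝ) {w : ℝ≥0} (hw : w ≠ 0) {g : ℝ × ℝ → ℝ} (hg : Measurable g)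
    (hg1 : ∀ y, ‖g y‖ ≤ 1) :
    Integrable (fun z : Ω × ℝ => Real.exp (L z.1 + c * z.2) * g (V z.1, z.2))
      (ν.prod (gaussianReal b w)) ∧
    ∫ z, Real.exp (L z.1 + c * z.2) * g (V z.1, z.2) ∂(ν.prod (gaussianReal b w)) =
      Real.exp (ν[L] + Var[L; ν] / 2 + (c * b + c ^ 2 * w / 2)) *
      ∫ y, g y ∂((gaussianReal (ν[V] + cov[L, V; ν]) Var[V; ν].toNNReal).prod
        (gaussianReal (b + c * w) w)) := by
  have hν := h.isProbabilityMeasure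
  have hexp : Integrable (fun z : Ω × ℝ => Real.exp (L z.1 + c * z.2))
      (ν.prod (gaussianReal b w)) := by
    simp only [Real.exp_add]
    exact (integrable_exp_of_hasGaussianLaw h.fst).mul_prod (integrable_exp_mul_gaussianReal c)
  have hint : Integrable (fun z : Ω × ℝ => Real.exp (L z.1 + c * z.2) * g (V z.1, z.2))
      (ν.prod (gaussianReal b w)) :=
    hexp.mul_bdd (c := 1)
      (hg.comp (by fun_prop : Measurable fun z : Ω × ℝ => (V z.1, z.2))).aestronglyMeasurable
      (.of_forall fun z => hg1 _)
  have hgint : ∀ (m m' : ℝ) (v v' : ℝ≥0),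
      Integrable g ((gaussianReal m v).prod (gaussianReal m' v')) := fun m m' v v' =>
    Integrable.of_bound (by fun_prop) 1 (.of_forall hg1)
  refine ⟨hint, ?_⟩
  -- Integrate over `Ω` first, tilting `V` with the last variable frozen; then tilt that variable.
  rw [integral_prod_symm _ hint, integral_prod_symm _ (hgint _ _ _ _)]
  have : ∀ x, ∫ ω, Real.exp (L ω + c * x) * g (V ω, x) ∂ν =
      Real.exp (ν[L] + Var[L; ν] / 2) * (Real.exp (c * x) *
      ∫ v, g (v, x) ∂(gaussianReal (ν[V] + cov[L, V; ν]) Var[V; ν].toNNReal)) := by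
    intro x
    rw [mul_left_comm, ← integral_exp_mul_comp h hV (g := fun v => g (v, x)) (by fun_prop),
      ← integral_const_mul]
    congr with ω
    rw [Real.exp_add]
    ring
  simp only [this]
  rw [integral_const_mul, integral_exp_mul_gaussianReal hw, ← mul_assoc, ← Real.exp_add]

end Tilt

/-! ### Gaussian probabilities of half-lines and quadrants -/

lemma gaussianReal_real_Iic (a w : ℝ) {s : ℝ} (hs : 0 < s) :
    (gaussianReal a (Real.toNNReal (s ^ 2))).real (Set.Iic w) = Phi1 ((w - a) / s) := by
  have hmap : (gaussianReal a (Real.toNNReal (s ^ 2))).map (fun x => (x - a) / s) =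
      gaussianReal 0 1 := by
    have := Measure.map_map (μ := gaussianReal a (Real.toNNReal (s ^ 2)))
      (measurable_id.div_const s) (measurable_id.sub_const a)
    simp only [Function.comp_def, id_eq] at this
    rw [← this, gaussianReal_map_sub_const, gaussianReal_map_div_const]
    congr 1
    · simp
    · ext
      simp [hs.ne', sq_nonneg]
  rw [Phi1, cdf_eq_real, ← hmap, map_measureReal_apply (by fun_prop) measurableSet_Iic]
  congr 1
  ext x
  simp [div_le_div_iff_of_pos_right hs]

lemma posSemidef_corr {r : ℝ} (hr : r ^ 2 ≤ 1) :
    (!![1, r; r, 1] : Matrix (Fin 2) (Fin 2) ℝ).PosSemidef := by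
  refine Matrix.PosSemidef.of_dotProduct_mulVec_nonneg ?_ fun x => ?_
  · ext i j
    fin_cases i <;> fin_cases j <;> simp
  · simp [Matrix.mulVec, dotProduct, Fin.sum_univ_two]
    nlinarith [sq_nonneg (x 0 + r * x 1), mul_nonneg (sub_nonneg.2 hr) (sq_nonneg (x 1))]

/-- Comparison of characteristic functions: both exponents are the same quadratic form in `θ`, by
`hd2` and `ε ^ 2 = 1`. -/
theorem map_prod_gaussianReal_eq {a b s t h ε d : ℝ} (ht : 0 < t) (hd : 0 < d)
    (hd2 : d ^ 2 = h ^ 2 * t ^ 2 + s ^ 2) (hε : ε ^ 2 = 1) :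
    ((gaussianReal a (Real.toNNReal (s ^ 2))).prod (gaussianReal b (Real.toNNReal (t ^ 2)))).map
      (fun z => WithLp.toLp 2 ![(z.2 - b) / t, ε * ((z.1 - a) + h * (z.2 - b)) / d]) =
    multivariateGaussian (0 : EuclideanSpace ℝ (Fin 2))
      !![1, ε * h * t / d; ε * h * t / d, 1] := by
  have hr : (ε * h * t / d) ^ 2 ≤ 1 := by
    rw [div_pow, div_le_one (by positivity), hd2, mul_pow, mul_pow, hε]
    nlinarith [sq_nonneg s]
  have hmeas : Measurable (fun z : ℝ × ℝ =>
      WithLp.toLp 2 ![(z.2 - b) / t, ε * ((z.1 - a) + h * (z.2 - b)) / d]) := by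
    refine (WithLp.measurable_toLp 2 _).comp (measurable_pi_iff.2 fun i => ?_)
    fin_cases i <;> simp <;> fun_prop
  have := Measure.isProbabilityMeasure_map (μ := (gaussianReal a (Real.toNNReal (s ^ 2))).prod
    (gaussianReal b (Real.toNNReal (t ^ 2)))) hmeas.aemeasurable
  refine Measure.ext_of_charFun (funext fun θ => ?_)
  rw [charFun_multivariateGaussian (posSemidef_corr hr), charFun_apply,
    integral_map hmeas.aemeasurable (by fun_prop)]
  -- Coefficients of `z.1` and `z.2` in the inner product with `θ`.
  set c₁ : ℝ := θ 1 * ε / d with hc₁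
  set c₂ : ℝ := θ 0 / t + θ 1 * ε * h / d with hc₂
  have : ∀ z : ℝ × ℝ, Complex.exp (inner ℝ (WithLp.toLp 2
        ![(z.2 - b) / t, ε * ((z.1 - a) + h * (z.2 - b)) / d]) θ * Complex.I) =
      Complex.exp (-(c₁ * a + c₂ * b) * Complex.I) *
      (Complex.exp (c₁ * z.1 * Complex.I) * Complex.exp (c₂ * z.2 * Complex.I)) := by
    intro z
    rw [← Complex.exp_add, ← Complex.exp_add]
    congr 1
    simp [PiLp.inner_apply, Fin.sum_univ_two, hc₁, hc₂]
    ring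
  simp only [this]
  rw [integral_const_mul, integral_prod_mul (fun v : ℝ => Complex.exp (c₁ * v * Complex.I))
    (fun x : ℝ => Complex.exp (c₂ * x * Complex.I)), ← charFun_apply_real, ← charFun_apply_real,
    charFun_gaussianReal, charFun_gaussianReal, ← Complex.exp_add, ← Complex.exp_add]
  congr 1
  rw [Real.coe_toNNReal _ (sq_nonneg _), Real.coe_toNNReal _ (sq_nonneg _)]
  have hquad : s ^ 2 * c₁ ^ 2 + t ^ 2 * c₂ ^ 2 =
      θ 0 ^ 2 + 2 * (ε * h * t / d) * θ 0 * θ 1 + θ 1 ^ 2 := by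
    have : (θ 1) ^ 2 = (θ 1) ^ 2 * ε ^ 2 * (h ^ 2 * t ^ 2 + s ^ 2) / d ^ 2 := by
      rw [← hd2, hε]; field_simp
    rw [this, hc₁, hc₂]
    field_simp
    ring
  have hquad' := congrArg (Complex.ofReal) hquad
  push_cast at hquad'
  simp [Matrix.mulVec, dotProduct, Fin.sum_univ_two]
  linear_combination (-1/2 : ℂ) * hquad'

theorem prod_gaussianReal_real_quadrant {a b s t h ε d : ℝ} (ht : 0 < t) (hd : 0 < d)
    (hd2 : d ^ 2 = h ^ 2 * t ^ 2 + s ^ 2) (hε : ε ^ 2 = 1) (x w : ℝ) :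
    ((gaussianReal a (Real.toNNReal (s ^ 2))).prod (gaussianReal b (Real.toNNReal (t ^ 2)))).real
      {z | z.2 ≤ x ∧ ε * (z.1 + h * z.2) ≤ ε * w} =
    Phi2 ((x - b) / t) (ε * (w - (a + h * b)) / d) (ε * h * t / d) := by
  rw [Phi2, ← map_prod_gaussianReal_eq (a := a) (b := b) ht hd hd2 hε, map_measureReal_apply]
  · congr 1
    ext z
    simp only [Set.mem_ofPred_eq, Set.mem_preimage, Matrix.cons_val_zero, Matrix.cons_val_one]
    rw [div_le_div_iff_of_pos_right ht, div_le_div_iff_of_pos_right hd]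
    refine and_congr ⟨fun h => by linarith, fun h => by linarith⟩
      ⟨fun h => by linarith, fun h => by linarith⟩
  · refine (WithLp.measurable_toLp 2 _).comp (measurable_pi_iff.2 fun i => ?_)
    fin_cases i <;> simp <;> fun_prop
  · exact (measurableSet_le (f := fun z : EuclideanSpace ℝ (Fin 2) => z 0) (by fun_prop)
      measurable_const).inter (measurableSet_le (f := fun z : EuclideanSpace ℝ (Fin 2) => z 1)
        (by fun_prop) measurable_const)

lemma gaussianReal_real_signed_halfLine {a t : ℝ} (ht : 0 < t) {ε : ℝ} (hε : ε = 1 ∨ ε = -1) (w : ℝ) :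
    (gaussianReal a (Real.toNNReal (t ^ 2))).real {x | ε * x ≤ ε * w} =
      Phi1 (ε * (w - a) / t) := by
  rcases hε with rfl | rfl
  · simpa [Set.Iic_def] using gaussianReal_real_Iic a w ht
  · have := gaussianReal_real_Iic (-a) (-w) ht
    rw [← gaussianReal_map_neg, map_measureReal_apply (by fun_prop) measurableSet_Iic] at this
    convert this using 2
    · ext; simp
    · ring

/-! ### Integration against a conditional law -/

section CondLaw

variable {Ω E : Type*} {m mΩ : MeasurableSpace Ω} [MeasurableSpace E] {Q : Measure Ω}
  [IsProbabilityMeasure Q] {Y : Ω → E} {κ : Ω → Measure E}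

/-- Integrating the defining identity over `s` upgrades a statement about single events, each with
its own null set, to an equality of measures. This needs no regularity of `E`. -/
lemma HasCondLaw.map_restrict_eq_bind (h : HasCondLaw Q m Y κ) (hm : m ≤ mΩ) (hY : Measurable Y)
    (hκ : Measurable[m] κ) (hκ1 : ∀ ω, IsProbabilityMeasure (κ ω)) {s : Set Ω}
    (hs : MeasurableSet[m] s) : (Q.restrict s).map Y = (Q.restrict s).bind κ := by
  ext A hA
  rw [Measure.map_apply hY hA, Measure.bind_apply hA (hκ.mono hm le_rfl).aemeasurable]
  have hint : Integrable ((Y ⁻¹' A).indicator (fun _ => (1 : ℝ))) Q :=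
    (integrable_const _).indicator (hY hA)
  have h1 := condLExp_ofReal m hint
    (.of_forall fun ω => Set.indicator_nonneg (fun _ _ => zero_le_one) ω)
  have h2 : condLExp m Q (fun ω => ENNReal.ofReal ((Y ⁻¹' A).indicator (fun _ => (1 : ℝ)) ω))
      =ᵐ[Q] fun ω => κ ω A := by
    filter_upwards [h1, h A hA] with ω h3 h4
    rw [h3, h4, ofReal_measureReal]
  rw [← lintegral_congr_ae (ae_restrict_of_ae h2), setLIntegral_condLExp hm Q _ hs]
  have : (fun ω => ENNReal.ofReal ((Y ⁻¹' A).indicator (fun _ => (1 : ℝ)) ω)) =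
      (Y ⁻¹' A).indicator 1 := by
    ext ω
    by_cases hω : ω ∈ Y ⁻¹' A <;> simp [hω]
  rw [this, lintegral_indicator_one (hY hA)]

theorem HasCondLaw.condLExp_comp (h : HasCondLaw Q m Y κ) (hm : m ≤ mΩ) (hY : Measurable Y)
    (hκ : Measurable[m] κ) (hκ1 : ∀ ω, IsProbabilityMeasure (κ ω)) {f : E → ℝ≥0∞}
    (hf : Measurable f) :
    condLExp m Q (fun ω => f (Y ω)) =ᵐ[Q] fun ω => ∫⁻ y, f y ∂(κ ω) := by
  refine (ae_eq_condLExp (hm := hm) Q _ ((Measure.measurable_lintegral hf).comp hκ)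
    fun s hs => ?_).symm
  rw [← lintegral_map (μ := Q.restrict s) hf hY, h.map_restrict_eq_bind hm hY hκ hκ1 hs,
    Measure.lintegral_bind (hκ.mono hm le_rfl).aemeasurable hf.aemeasurable]
  rfl

lemma HasCondLaw.ae_comp (h : HasCondLaw Q m Y κ) (hm : m ≤ mΩ) (hY : Measurable Y)
    (hκ : Measurable[m] κ) (hκ1 : ∀ ω, IsProbabilityMeasure (κ ω)) {P : E → Prop}
    (hP : MeasurableSet {y | P y}) (hae : ∀ ω, ∀ᵐ y ∂(κ ω), P y) : ∀ᵐ ω ∂Q, P (Y ω) := by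
  have h1 := h.map_restrict_eq_bind hm hY hκ hκ1 (s := Set.univ) .univ
  rw [Measure.restrict_univ] at h1
  have h2 : ∀ᵐ y ∂(Q.map Y), P y := by
    have h3 := Measure.bind_apply (m := Q) hP.compl (hκ.mono hm le_rfl).aemeasurable
    rw [h1, ae_iff]
    refine h3.trans ?_
    exact (lintegral_congr fun ω => ae_iff.1 (hae ω)).trans lintegral_zero
  exact (ae_map_iff hY.aemeasurable hP).1 h2

end CondLaw

/-! ### Integrals of indicators -/

namespace Params

@[fun_prop]
lemma measurable_leInd {α : Type*} [MeasurableSpace α] {f g : α → ℝ} (hf : Measurable f)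
    (hg : Measurable g) : Measurable fun a => leInd (f a) (g a) :=
  Measurable.ite (measurableSet_le hf hg) measurable_const measurable_const

lemma leInd_nonneg (a b : ℝ) : 0 ≤ leInd a b := by rw [leInd]; split_ifs <;> simp

lemma leInd_le_one (a b : ℝ) : leInd a b ≤ 1 := by rw [leInd]; split_ifs <;> simp

lemma norm_leInd_mul_le_one (a b c d : ℝ) : ‖leInd a b * leInd c d‖ ≤ 1 := by
  rw [Real.norm_of_nonneg (mul_nonneg (leInd_nonneg _ _) (leInd_nonneg _ _))]
  exact mul_le_one₀ (leInd_le_one _ _) (leInd_nonneg _ _) (leInd_le_one _ _)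

lemma integral_leInd {α : Type*} [MeasurableSpace α] {ν : Measure α} {f g : α → ℝ}
    (hf : Measurable f) (hg : Measurable g) :
    ∫ a, leInd (f a) (g a) ∂ν = ν.real {a | f a ≤ g a} := by
  rw [← integral_indicator_one (measurableSet_le hf hg)]
  rfl

lemma integral_leInd_mul {α : Type*} [MeasurableSpace α] {ν : Measure α} {f g f' g' : α → ℝ}
    (hf : Measurable f) (hg : Measurable g) (hf' : Measurable f') (hg' : Measurable g') :
    ∫ a, leInd (f a) (g a) * leInd (f' a) (g' a) ∂ν = ν.real {a | f a ≤ g a ∧ f' a ≤ g' a} := by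
  have hset : MeasurableSet {a | f a ≤ g a ∧ f' a ≤ g' a} :=
    (measurableSet_le hf hg).inter (measurableSet_le hf' hg')
  rw [← integral_indicator_one hset]
  congr with a
  simp only [leInd, Set.indicator, Set.mem_ofPred_eq, Pi.one_apply]
  split_ifs <;> simp_all

variable {p : Params}

/-! ### The conditional law of the factors -/

lemma cov_self (i : Fin 2) : p.cov i i = p.σ i ^ 2 := by fin_cases i <;> simp [cov]

lemma cov_other (i : Fin 2) : p.cov i (other i) = p.ρ * p.σ i * p.σ (other i) := by
  fin_cases i <;> simp [cov, other]; ring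

lemma varRatio_eq (i : Fin 2) :
    p.varRatio = p.σ i ^ 2 - 2 * p.ρ * p.σ i * p.σ (other i) + p.σ (other i) ^ 2 := by
  fin_cases i <;> simp [varRatio, other]; ring

lemma posSemidef_cov (hρ : p.ρ ∈ Set.Icc (-1 : ℝ) 1) : p.cov.PosSemidef := by
  refine Matrix.PosSemidef.of_dotProduct_mulVec_nonneg ?_ fun x => ?_
  · ext i j
    fin_cases i <;> fin_cases j <;> simp [cov]
  · have hρ2 : 0 ≤ 1 - p.ρ ^ 2 := by nlinarith [hρ.1, hρ.2]
    simp [cov, Matrix.mulVec, dotProduct, Fin.sum_univ_two]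
    nlinarith [sq_nonneg (x 0 * p.σ 0 + p.ρ * x 1 * p.σ 1),
      mul_nonneg hρ2 (sq_nonneg (x 1 * p.σ 1))]

instance isProbabilityMeasure_factorLaw (μ : Fin 2 → ℝ) (μd : ℝ) :
    IsProbabilityMeasure (p.factorLaw μ μd) := by
  rw [factorLaw]; infer_instance

lemma factorLaw_eq_map (μ : Fin 2 → ℝ) (μd : ℝ) :
    p.factorLaw μ μd = (p.factorLaw 0 0).map fun z => (WithLp.toLp 2 μ + z.1, μd + z.2) := by
  have h1 : multivariateGaussian (WithLp.toLp 2 μ) p.cov =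
      (multivariateGaussian 0 p.cov).map (fun z => WithLp.toLp 2 μ + z) := by
    rw [multivariateGaussian, multivariateGaussian, Measure.map_map (by fun_prop) (by fun_prop)]
    congr with z
    simp
  have h2 : gaussianReal μd (Real.toNNReal (p.σd ^ 2)) =
      (gaussianReal 0 (Real.toNNReal (p.σd ^ 2))).map (fun x => μd + x) := by
    rw [gaussianReal_map_const_add, zero_add]
  rw [factorLaw, h1, h2, factorLaw, Measure.map_prod_map _ _ (by fun_prop) (by fun_prop)]
  rfl

/-- Only the location depends on the parameter, so the mass of a set is that of a section of its
preimage under a fixed centred law. -/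
lemma measurable_factorLaw {α : Type*} [MeasurableSpace α] {μ : α → Fin 2 → ℝ} {μd : α → ℝ}
    (hμ : ∀ i, Measurable fun a => μ a i) (hμd : Measurable μd) :
    Measurable fun a => p.factorLaw (μ a) (μd a) := by
  refine Measure.measurable_of_measurable_coe _ fun A hA => ?_
  have hμ' : Measurable fun a => WithLp.toLp 2 (μ a) :=
    (WithLp.measurable_toLp 2 _).comp (measurable_pi_iff.2 hμ)
  have h : Measurable fun y : α × (EuclideanSpace ℝ (Fin 2) × ℝ) =>
      (WithLp.toLp 2 (μ y.1) + y.2.1, μd y.1 + y.2.2) := by fun_prop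
  convert measurable_measure_prodMk_left (ν := p.factorLaw 0 0) (h hA) using 2 with a
  rw [factorLaw_eq_map, Measure.map_apply (by fun_prop) hA]
  rfl

section Moments

variable (μ : Fin 2 → ℝ) (i : Fin 2)

lemma hasGaussianLaw_linear (a b : ℝ) :
    HasGaussianLaw (fun z : EuclideanSpace ℝ (Fin 2) =>
      (a * z i + b * z (other i), z i - z (other i)))
      (multivariateGaussian (WithLp.toLp 2 μ) p.cov) :=
  (IsGaussian.hasGaussianLaw_id (μ := multivariateGaussian (WithLp.toLp 2 μ) p.cov)).map_fun
    ((a • EuclideanSpace.proj (𝕜 := ℝ) i + b • EuclideanSpace.proj (other i)).prod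
      (EuclideanSpace.proj (𝕜 := ℝ) i - EuclideanSpace.proj (other i)))

lemma memLp_eval (j : Fin 2) : MemLp (fun z : EuclideanSpace ℝ (Fin 2) => z j) 2
    (multivariateGaussian (WithLp.toLp 2 μ) p.cov) :=
  ((IsGaussian.hasGaussianLaw_id (μ := multivariateGaussian (WithLp.toLp 2 μ) p.cov)).map_fun
    (EuclideanSpace.proj (𝕜 := ℝ) j)).memLp_two

lemma integral_eval (hρ : p.ρ ∈ Set.Icc (-1 : ℝ) 1) (j : Fin 2) :
    ∫ z, z j ∂(multivariateGaussian (WithLp.toLp 2 μ) p.cov) = μ j := by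
  have := (measurePreserving_eval_multivariateGaussian (μ := WithLp.toLp 2 μ) (i := j)
    (posSemidef_cov hρ))
  rw [← integral_map (φ := fun z : EuclideanSpace ℝ (Fin 2) => z j) (f := fun x => x)
    (by fun_prop) (by fun_prop), this.map_eq, integral_id_gaussianReal]

lemma integral_linear (hρ : p.ρ ∈ Set.Icc (-1 : ℝ) 1) (a b : ℝ) :
    ∫ z, (a * z i + b * z (other i)) ∂(multivariateGaussian (WithLp.toLp 2 μ) p.cov) =
      a * μ i + b * μ (other i) := by
  rw [integral_add, integral_const_mul, integral_const_mul, integral_eval _ hρ, integral_eval _ hρ]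
  all_goals exact ((memLp_eval μ _).integrable one_le_two).const_mul _

lemma covariance_linear (hρ : p.ρ ∈ Set.Icc (-1 : ℝ) 1) (a b a' b' : ℝ) :
    cov[fun z => a * z i + b * z (other i), fun z => a' * z i + b' * z (other i);
      multivariateGaussian (WithLp.toLp 2 μ) p.cov] =
    a * a' * p.σ i ^ 2 + (a * b' + a' * b) * (p.ρ * p.σ i * p.σ (other i))
      + b * b' * p.σ (other i) ^ 2 := by
  have hm := fun (c : ℝ) (j : Fin 2) => (memLp_eval (p := p) μ j).const_mul c
  have hc := covariance_eval_multivariateGaussian (μ := WithLp.toLp 2 μ) (posSemidef_cov hρ)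
  have hadd : ∀ c d : ℝ, (fun z : EuclideanSpace ℝ (Fin 2) => c * z i + d * z (other i)) =
      (fun z => c * z i) + fun z => d * z (other i) := fun _ _ => rfl
  rw [hadd, hadd, covariance_add_left (hm a _) (hm b _) ((hm a' _).add (hm b' _)),
    covariance_add_right (hm _ _) (hm _ _) (hm _ _),
    covariance_add_right (hm _ _) (hm _ _) (hm _ _)]
  simp only [covariance_const_mul_left, covariance_const_mul_right, hc, cov_self, cov_other]
  have := cov_other (p := p) (other i)
  rw [other_other] at this
  rw [this]
  ring

lemma variance_linear (hρ : p.ρ ∈ Set.Icc (-1 : ℝ) 1) (a b : ℝ) :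
    Var[fun z => a * z i + b * z (other i); multivariateGaussian (WithLp.toLp 2 μ) p.cov] =
    a ^ 2 * p.σ i ^ 2 + 2 * a * b * (p.ρ * p.σ i * p.σ (other i)) + b ^ 2 * p.σ (other i) ^ 2 := by
  rw [← covariance_self (by fun_prop), covariance_linear _ _ hρ]
  ring

lemma integral_diff (hρ : p.ρ ∈ Set.Icc (-1 : ℝ) 1) :
    ∫ z, (z i - z (other i)) ∂(multivariateGaussian (WithLp.toLp 2 μ) p.cov) =
    μ i - μ (other i) := by
  have := integral_linear μ i hρ 1 (-1)
  simpa only [one_mul, neg_mul, ← sub_eq_add_neg] using this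

lemma variance_diff (hρ : p.ρ ∈ Set.Icc (-1 : ℝ) 1) :
    Var[fun z => z i - z (other i); multivariateGaussian (WithLp.toLp 2 μ) p.cov] =
      p.varRatio := by
  have := variance_linear μ i hρ 1 (-1)
  simp only [one_mul, neg_mul, ← sub_eq_add_neg] at this
  rw [this, varRatio_eq i]
  ring

lemma covariance_linear_diff (hρ : p.ρ ∈ Set.Icc (-1 : ℝ) 1) (a b : ℝ) :
    cov[fun z => a * z i + b * z (other i), fun z => z i - z (other i);
      multivariateGaussian (WithLp.toLp 2 μ) p.cov] =
    a * p.σ i ^ 2 + (b - a) * (p.ρ * p.σ i * p.σ (other i)) - b * p.σ (other i) ^ 2 := by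
  have := covariance_linear μ i hρ a b 1 (-1)
  simp only [one_mul, neg_mul, ← sub_eq_add_neg] at this
  rw [this]
  ring

end Moments

end Params

/-- `f` is integrable with integral `v`. -/
def IntegralEq {α : Type*} [MeasurableSpace α] (ν : Measure α) (f : α → ℝ) (v : ℝ) : Prop :=
  Integrable f ν ∧ ∫ a, f a ∂ν = v

namespace IntegralEq

variable {α : Type*} [MeasurableSpace α] {ν : Measure α} {f g : α → ℝ} {v w : ℝ}

lemma congr (h : IntegralEq ν f v) (hf : ∀ a, g a = f a) (hv : v = w) : IntegralEq ν g w := by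
  obtain rfl : g = f := funext hf
  exact hv ▸ h

lemma const_mul (h : IntegralEq ν f v) (c : ℝ) : IntegralEq ν (fun a => c * f a) (c * v) :=
  ⟨h.1.const_mul c, by rw [integral_const_mul, h.2]⟩

lemma add (h : IntegralEq ν f v) (h' : IntegralEq ν g w) :
    IntegralEq ν (fun a => f a + g a) (v + w) :=
  ⟨h.1.add h'.1, by rw [integral_add h.1 h'.1, h.2, h'.2]⟩

lemma sub (h : IntegralEq ν f v) (h' : IntegralEq ν g w) :
    IntegralEq ν (fun a => f a - g a) (v - w) :=
  ⟨h.1.sub h'.1, by rw [integral_sub h.1 h'.1, h.2, h'.2]⟩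

lemma sum {ι : Type*} [Fintype ι] {f : ι → α → ℝ} {v : ι → ℝ} (h : ∀ i, IntegralEq ν (f i) (v i)) :
    IntegralEq ν (fun a => ∑ i, f i a) (∑ i, v i) :=
  ⟨integrable_finsetSum _ fun i _ => (h i).1, by
    rw [integral_finsetSum _ fun i _ => (h i).1]
    exact Finset.sum_congr rfl fun i _ => (h i).2⟩

end IntegralEq

namespace Params

variable {p : Params}

/-! ### Exponential moments on half-lines and quadrants -/

/-- Expectation of `exp (a uᵢ + b uⱼ + c x)` under the law of the factors. -/
def expMoment (p : Params) (μ : Fin 2 → ℝ) (μd : ℝ) (i : Fin 2) (a b c : ℝ) : ℝ :=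
  Real.exp (a * μ i + b * μ (other i) + (a ^ 2 * p.σ i ^ 2
    + 2 * a * b * (p.ρ * p.σ i * p.σ (other i)) + b ^ 2 * p.σ (other i) ^ 2) / 2
    + (c * μd + c ^ 2 * p.σd ^ 2 / 2))

/-- Mean of the log price ratio after the exponential change of measure. -/
def tiltedMean (p : Params) (μ : Fin 2 → ℝ) (i : Fin 2) (a b : ℝ) : ℝ :=
  μ i - μ (other i)
    + (a * p.σ i ^ 2 + (b - a) * (p.ρ * p.σ i * p.σ (other i)) - b * p.σ (other i) ^ 2)

section Factor

variable (μ : Fin 2 → ℝ) (μd : ℝ) (i : Fin 2)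

lemma integralEq_exp_mul (hρ : p.ρ ∈ Set.Icc (-1 : ℝ) 1) (hvar : 0 < p.varRatio) (hσd : 0 < p.σd)
    (a b c : ℝ) {g : ℝ × ℝ → ℝ} (hg : Measurable g) (hg1 : ∀ y, ‖g y‖ ≤ 1) :
    IntegralEq (p.factorLaw μ μd)
      (fun z => Real.exp (a * z.1 i + b * z.1 (other i) + c * z.2) *
        g (z.1 i - z.1 (other i), z.2))
      (p.expMoment μ μd i a b c *
        ∫ y, g y ∂((gaussianReal (p.tiltedMean μ i a b) (Real.toNNReal (p.sdRatio ^ 2))).prod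
          (gaussianReal (μd + c * p.σd ^ 2) (Real.toNNReal (p.σd ^ 2))))) := by
  have hw : Real.toNNReal (p.σd ^ 2) ≠ 0 := by simp [hσd.ne']
  have h := integral_exp_mul_comp_prod (hasGaussianLaw_linear (p := p) μ i a b) (by fun_prop)
    (by rw [variance_diff _ _ hρ]; exact hvar.ne') c μd hw hg hg1
  rw [variance_diff _ _ hρ, variance_linear _ _ hρ, integral_linear _ _ hρ, integral_diff _ _ hρ,
    covariance_linear_diff _ _ hρ, Real.coe_toNNReal _ (sq_nonneg _)] at h
  rwa [sdRatio, Real.sq_sqrt hvar.le]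

lemma sdRatio_pos (hvar : 0 < p.varRatio) : 0 < p.sdRatio := Real.sqrt_pos.2 hvar

/-- Ends of the stack: the price no longer depends on the demand, so independence splits the
probability. The sign selects the lower (`1`) or the upper (`-1`) end. -/
lemma integralEq_halfLines (hρ : p.ρ ∈ Set.Icc (-1 : ℝ) 1) (hvar : 0 < p.varRatio) (hσd : 0 < p.σd)
    (a : ℝ) {ε : ℝ} (hε : ε = 1 ∨ ε = -1) (x w : ℝ) :
    IntegralEq (p.factorLaw μ μd)
      (fun z => Real.exp (a * z.1 i) * (leInd (ε * z.2) (ε * x) *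
        leInd (ε * (z.1 i - z.1 (other i))) (ε * w)))
      (p.expMoment μ μd i a 0 0 * (Phi1 (ε * (x - μd) / p.σd) *
        Phi1 (ε * (w - p.tiltedMean μ i a 0) / p.sdRatio))) := by
  have hs := sdRatio_pos hvar
  refine (integralEq_exp_mul μ μd i hρ hvar hσd a 0 0
    (g := fun y => leInd (ε * y.2) (ε * x) * leInd (ε * y.1) (ε * w))
    (by fun_prop) (fun _ => norm_leInd_mul_le_one _ _ _ _)).congr (fun z => by simp) ?_
  congr 1
  simp_rw [mul_comm (leInd (ε * Prod.snd _) _)]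
  rw [integral_prod_mul (fun v => leInd (ε * v) (ε * w)) (fun v => leInd (ε * v) (ε * x)),
    integral_leInd (by fun_prop) (by fun_prop), integral_leInd (by fun_prop) (by fun_prop),
    gaussianReal_real_signed_halfLine hs hε,
    gaussianReal_real_signed_halfLine hσd hε, mul_comm]
  simp

/-- Inside the stack the price comparison involves the demand through `m i * x`, which correlates
the two constraints; a strip of demand is a difference of two quadrants. -/
lemma integralEq_strip (hρ : p.ρ ∈ Set.Icc (-1 : ℝ) 1) (hvar : 0 < p.varRatio) (hσd : 0 < p.σd)
    (a b c : ℝ) {ε : ℝ} (hε : ε = 1 ∨ ε = -1) (x₁ x₂ w : ℝ) :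
    IntegralEq (p.factorLaw μ μd)
      (fun z => Real.exp (a * z.1 i + b * z.1 (other i) + c * z.2) *
        ((leInd z.2 x₁ - leInd z.2 x₂) *
          leInd (ε * (z.1 i - z.1 (other i) + p.m i * z.2)) (ε * w)))
      (p.expMoment μ μd i a b c *
        Phi2Diff ((x₁ - (μd + c * p.σd ^ 2)) / p.σd) ((x₂ - (μd + c * p.σd ^ 2)) / p.σd)
          (ε * (w - (p.tiltedMean μ i a b + p.m i * (μd + c * p.σd ^ 2))) / p.sdDemand i)
          (ε * p.m i * p.σd / p.sdDemand i)) := by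
  have hd : 0 < p.m i ^ 2 * p.σd ^ 2 + p.varRatio := by positivity
  have key : ∀ x, IntegralEq (p.factorLaw μ μd)
      (fun z => Real.exp (a * z.1 i + b * z.1 (other i) + c * z.2) *
        (leInd z.2 x * leInd (ε * (z.1 i - z.1 (other i) + p.m i * z.2)) (ε * w)))
      (p.expMoment μ μd i a b c *
        Phi2 ((x - (μd + c * p.σd ^ 2)) / p.σd)
          (ε * (w - (p.tiltedMean μ i a b + p.m i * (μd + c * p.σd ^ 2))) / p.sdDemand i)
          (ε * p.m i * p.σd / p.sdDemand i)) := by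
    intro x
    refine (integralEq_exp_mul μ μd i hρ hvar hσd a b c
      (g := fun y => leInd y.2 x * leInd (ε * (y.1 + p.m i * y.2)) (ε * w))
      (by fun_prop) (fun _ => norm_leInd_mul_le_one _ _ _ _)).congr (fun z => rfl) ?_
    rw [integral_leInd_mul (by fun_prop) (by fun_prop) (by fun_prop) (by fun_prop),
      prod_gaussianReal_real_quadrant (d := p.sdDemand i) hσd (Real.sqrt_pos.2 hd)]
    · rw [sdDemand, Real.sq_sqrt hd.le, sdRatio, Real.sq_sqrt hvar.le]
    · rcases hε with rfl | rfl <;> norm_num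
  refine ((key x₁).sub (key x₂)).congr (fun z => by ring) ?_
  rw [Phi2Diff]
  ring

/-- For each fixed demand the log price ratio is a nondegenerate Gaussian, which has no atoms;
Fubini concludes. -/
lemma ae_linear_ne (hρ : p.ρ ∈ Set.Icc (-1 : ℝ) 1) (hvar : 0 < p.varRatio) (h w : ℝ) :
    ∀ᵐ z ∂(p.factorLaw μ μd), z.1 i - z.1 (other i) + h * z.2 ≠ w := by
  have hs : MeasurableSet {z : EuclideanSpace ℝ (Fin 2) × ℝ |
      z.1 i - z.1 (other i) + h * z.2 = w} := measurableSet_eq_fun (by fun_prop) (by fun_prop)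
  rw [ae_iff]
  simp only [ne_eq, not_not]
  rw [factorLaw, Measure.prod_apply_symm hs]
  refine (lintegral_congr fun x => ?_).trans lintegral_zero
  have hlaw := (hasGaussianLaw_linear (p := p) μ i 0 0).snd.map_eq_gaussianReal
  rw [variance_diff _ _ hρ] at hlaw
  have hna := nullSingletonClass_gaussianReal
    (μ := ∫ z, (z i - z (other i)) ∂(multivariateGaussian (WithLp.toLp 2 μ) p.cov))
    (v := p.varRatio.toNNReal) (by simpa using hvar)
  have := Measure.map_apply (μ := multivariateGaussian (WithLp.toLp 2 μ) p.cov)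
    (f := fun z : EuclideanSpace ℝ (Fin 2) => z i - z (other i)) (by fun_prop)
    (measurableSet_singleton (w - h * x))
  rw [hlaw, measure_singleton] at this
  rw [this]
  congr 1
  ext z
  simp [eq_sub_iff_add_eq]

lemma ae_demand_ne (hσd : 0 < p.σd) (w : ℝ) : ∀ᵐ z ∂(p.factorLaw μ μd), z.2 ≠ w := by
  have hna := nullSingletonClass_gaussianReal (μ := μd) (v := Real.toNNReal (p.σd ^ 2))
    (by simp [hσd.ne'])
  have : {z : EuclideanSpace ℝ (Fin 2) × ℝ | ¬ z.2 ≠ w} = Set.univ ×ˢ {w} := by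
    ext z; simp
  rw [ae_iff, this, factorLaw, Measure.prod_prod, measure_singleton, mul_zero]

end Factor

end Params

lemma Phi2Diff_congr {x x' y y' z z' r r' : ℝ} (h1 : x = x') (h2 : y = y') (h3 : z = z')
    (h4 : r = r') : Phi2Diff x y z r = Phi2Diff x' y' z' r' := by
  rw [h1, h2, h3, h4]

namespace Params

variable {p : Params}

/-! ### The expected payoff in closed form -/

lemma log_forward (μ : Fin 2 → ℝ) (j : Fin 2) :
    Real.log (Real.exp (μ j + p.σ j ^ 2 / 2)) = μ j + p.σ j ^ 2 / 2 := Real.log_exp _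

lemma R_eq (n : ℕ) (μ : Fin 2 → ℝ) (i : Fin 2) (x y : ℝ) :
    p.R n (fun j => Real.exp (μ j + p.σ j ^ 2 / 2)) i x y =
      p.threshold i x y - p.tiltedMean μ i n 0 := by
  rw [R, log_forward, log_forward, threshold, tiltedMean]
  ring

/-- As the weights add up to one, the tilting exponent is `n * u i - n * α j * (u i - u j)`; the
second part lowers the covariance with the log ratio by `n * α j` times its variance. -/
lemma tiltedMean_both (hm : ∀ i, 0 < p.m i) (n : ℕ) (μ : Fin 2 → ℝ) (i : Fin 2) :
    p.tiltedMean μ i (n * p.α i) (n * p.α (other i)) =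
      p.tiltedMean μ i n 0 - n * p.α (other i) * p.varRatio := by
  have h : p.α i = 1 - p.α (other i) := by
    have := (add_pos (hm 0) (hm 1)).ne'
    fin_cases i <;> simp [α, other] <;> field_simp <;> ring
  rw [tiltedMean, tiltedMean, varRatio_eq i, h]
  ring

lemma bid_pow_exp (n : ℕ) (i : Fin 2) (ξ u : ℝ) :
    p.bid i ξ (Real.exp u) ^ n = Real.exp (n * (p.k i + p.m i * ξ)) * Real.exp (n * u) := by
  rw [bid_exp, ← Real.exp_nat_mul, ← Real.exp_add]
  ring_nf

lemma bid_forward_pow (n : ℕ) (μ : Fin 2 → ℝ) (μd : ℝ) (i : Fin 2) (ξ : ℝ) :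
    p.bid i ξ (Real.exp (μ i + p.σ i ^ 2 / 2)) ^ n * Real.exp (p.ν n i) =
      Real.exp (n * (p.k i + p.m i * ξ)) * p.expMoment μ μd i n 0 0 := by
  rw [bid_pow_exp, expMoment, ν, ← Real.exp_add, ← Real.exp_add, ← Real.exp_add]
  ring_nf

lemma bid_forward_pow_demand (n : ℕ) (μ : Fin 2 → ℝ) (μd : ℝ) (i : Fin 2) (y : ℝ) :
    p.bid i (μd - y) (Real.exp (μ i + p.σ i ^ 2 / 2)) ^ n * Real.exp (p.ζ n i) =
      Real.exp (n * (p.k i - p.m i * y)) * p.expMoment μ μd i n 0 (n * p.m i) := by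
  rw [bid_pow_exp, expMoment, ζ, ν, ← Real.exp_add, ← Real.exp_add, ← Real.exp_add]
  ring_nf

lemma bidBoth_pow_exp (n : ℕ) (i : Fin 2) (ξ : ℝ) (u : Fin 2 → ℝ) :
    p.bidBoth ξ (fun j => Real.exp (u j)) ^ n = Real.exp (n * p.β) *
      Real.exp (n * p.α i * u i + n * p.α (other i) * u (other i) + n * p.γ * ξ) := by
  rw [bidBoth_exp i, ← Real.exp_nat_mul, ← Real.exp_add]
  ring_nf

lemma η_eq (n : ℕ) (i : Fin 2) :
    p.η n = 1 / 2 * ((n : ℝ) ^ 2 - n) * (p.α i * p.σ i ^ 2 + p.α (other i) * p.σ (other i) ^ 2)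
    + (n : ℝ) ^ 2 / 2 * (p.γ ^ 2 * p.σd ^ 2 - p.α i * p.α (other i) * p.varRatio) := by
  fin_cases i <;> simp [η, other]; ring

lemma bidBoth_forward_pow (hm : ∀ i, 0 < p.m i) (n : ℕ) (μ : Fin 2 → ℝ) (μd : ℝ) (i : Fin 2) :
    p.bidBoth μd (fun j => Real.exp (μ j + p.σ j ^ 2 / 2)) ^ n * Real.exp (p.η n) =
      Real.exp (n * p.β) *
        p.expMoment μ μd i (n * p.α i) (n * p.α (other i)) (n * p.γ) := by
  have h : p.α i = 1 - p.α (other i) := by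
    have := (add_pos (hm 0) (hm 1)).ne'
    fin_cases i <;> simp [α, other] <;> field_simp <;> ring
  rw [bidBoth_pow_exp n i _ (fun j => μ j + p.σ j ^ 2 / 2), expMoment, η_eq n i, varRatio_eq i,
    ← Real.exp_add, ← Real.exp_add, ← Real.exp_add, h]
  ring_nf

theorem integralEq_payoff (hm : ∀ i, 0 < p.m i) (hρ : p.ρ ∈ Set.Icc (-1 : ℝ) 1)
    (hvar : 0 < p.varRatio) (hσd : 0 < p.σd) (iplus : Fin 2) (n : ℕ) (μ : Fin 2 → ℝ) (μd : ℝ) :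
    IntegralEq (p.factorLaw μ μd) (fun z => p.payoff iplus n (fun j => z.1 j) z.2)
      (p.momentFormula iplus n (fun j => Real.exp (μ j + p.σ j ^ 2 / 2)) μd) := by
  have hσ := hσd.ne'
  set F : Fin 2 → ℝ := fun j => Real.exp (μ j + p.σ j ^ 2 / 2)
  refine ((((IntegralEq.sum
      (v := fun i => Phi1 (-μd / p.σd) *
        (p.bid i 0 (F i) ^ n * Real.exp (p.ν n i) * Phi1 (p.R n F i 0 0 / p.sdRatio)))
      fun i => ?_).add (IntegralEq.sum
      (v := fun i => Phi1 ((μd - p.totalCap) / p.σd) * (p.bid i (p.cap i) (F i) ^ n *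
        Real.exp (p.ν n i) * Phi1 (-p.R n F i (p.cap i) (p.cap (other i)) / p.sdRatio)))
      fun i => ?_)).add (IntegralEq.sum (v := p.soleUnusedTerm n F μd) fun i => ?_)).add
      (IntegralEq.sum (v := p.soleExhaustedTerm n F μd) fun i => ?_)).add
      (IntegralEq.sum (v := p.bothTerm iplus n F μd) fun i => ?_) |>.congr (fun z => rfl) ?_
  · refine ((integralEq_halfLines μ μd i hρ hvar hσd n (.inl rfl) 0
      (p.threshold i 0 0)).const_mul (Real.exp (n * (p.k i + p.m i * 0)))).congr (fun z => ?_) ?_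
    · simp only [bid_pow_exp, one_mul]
      ring
    · rw [bid_forward_pow n μ μd, R_eq, one_mul, one_mul, zero_sub]
      ring
  · refine ((integralEq_halfLines μ μd i hρ hvar hσd n (.inr rfl) p.totalCap
      (p.threshold i (p.cap i) (p.cap (other i)))).const_mul
      (Real.exp (n * (p.k i + p.m i * p.cap i)))).congr (fun z => ?_) ?_
    · simp only [bid_pow_exp, neg_mul, one_mul]
      ring
    · rw [bid_forward_pow n μ μd, R_eq, neg_one_mul, neg_one_mul, neg_sub p.totalCap]
      ring
  · refine ((integralEq_strip μ μd i hρ hvar hσd n 0 (n * p.m i) (.inl rfl) (p.cap i) 0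
      (p.threshold i 0 0)).const_mul (Real.exp (n * (p.k i - p.m i * 0)))).congr (fun z => ?_) ?_
    · simp only [bid_exp, ← Real.exp_nat_mul, one_mul]
      have : Real.exp (n * (z.1 i + p.k i + p.m i * z.2)) = Real.exp (n * (p.k i - p.m i * 0)) *
          Real.exp (n * z.1 i + 0 * z.1 (other i) + n * p.m i * z.2) := by
        rw [← Real.exp_add]; ring_nf
      rw [this]
      ring
    · rw [soleUnusedTerm, R_eq]
      have := bid_forward_pow_demand (p := p) n μ μd i 0
      rw [sub_zero] at this
      rw [this, ← mul_assoc]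
      congr 1
      refine Phi2Diff_congr ?_ ?_ ?_ ?_
      · field_simp
        ring
      · field_simp
        ring
      · rw [threshold, threshold]
        ring
      · ring
  · refine ((integralEq_strip μ μd i hρ hvar hσd n 0 (n * p.m i) (.inr rfl) p.totalCap
      (p.cap (other i)) (p.threshold i (-p.cap (other i)) (p.cap (other i)))).const_mul
      (Real.exp (n * (p.k i - p.m i * p.cap (other i))))).congr (fun z => ?_) ?_
    · simp only [bid_exp, ← Real.exp_nat_mul, neg_mul, one_mul]
      have : Real.exp (n * (z.1 i + p.k i + p.m i * (z.2 - p.cap (other i)))) =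
          Real.exp (n * (p.k i - p.m i * p.cap (other i))) *
          Real.exp (n * z.1 i + 0 * z.1 (other i) + n * p.m i * z.2) := by
        rw [← Real.exp_add]; ring_nf
      rw [this]
      ring
    · rw [soleExhaustedTerm, R_eq, bid_forward_pow_demand, ← mul_assoc]
      congr 1
      refine Phi2Diff_congr ?_ ?_ ?_ ?_
      · field_simp
        ring
      · field_simp
        ring
      · rw [threshold, threshold]
        ring
      · ring
  · have key := fun x₁ x₂ w => integralEq_strip μ μd i hρ hvar hσd (n * p.α i)
      (n * p.α (other i)) (n * p.γ) (δ_eq iplus i) x₁ x₂ w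
    refine (((key p.totalCap (p.cap (other i))
      (p.threshold i (-p.cap (other i)) (p.cap (other i)))).sub
      (key (p.cap i) 0 (p.threshold i 0 0))).const_mul
      (δ iplus i * Real.exp (n * p.β))).congr (fun z => ?_) ?_
    · rw [bidBoth_pow_exp n i _ (fun j => z.1 j)]
      ring
    · have hδ : δ iplus i ≠ 0 := by rcases δ_eq iplus i with h | h <;> rw [h] <;> norm_num
      -- A sign is its own inverse, so multiplying by `δ` agrees with dividing by it, as the closed
      -- form does.
      have hδ' : δ iplus i = (δ iplus i)⁻¹ := by
        rcases δ_eq iplus i with h | h <;> rw [h] <;> norm_num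
      have hr : δ iplus i * p.m i * p.σd / p.sdDemand i =
          p.m i * p.σd / (δ iplus i * p.sdDemand i) := by
        rw [div_mul_eq_div_div_swap, div_eq_mul_inv _ (δ iplus i), ← hδ']
        ring
      have hy : ∀ a b : ℝ, a = b → δ iplus i * a / p.sdDemand i =
          b / (δ iplus i * p.sdDemand i) := by
        rintro a _ rfl
        rw [div_mul_eq_div_div_swap, div_eq_mul_inv _ (δ iplus i), ← hδ']
        ring
      rw [bothTerm, mul_assoc (δ iplus i) (p.bidBoth _ _ ^ n), bidBoth_forward_pow hm n μ μd i,
        R_eq, R_eq, tiltedMean_both hm]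
      rw [← mul_sub, ← mul_assoc, mul_assoc (δ iplus i), sub_eq_neg_add]
      congr 2
      · congr 1
        refine Phi2Diff_congr ?_ ?_ (hy _ _ ?_) hr
        · field_simp
          ring
        · field_simp
          ring
        · rw [threshold, threshold]
          ring
      · refine Phi2Diff_congr ?_ ?_ (hy _ _ ?_) hr
        · field_simp
          ring
        · field_simp
          ring
        · rw [threshold, threshold]
          ring
  · rw [momentFormula, lowerEndTerm, upperEndTerm, Finset.mul_sum, Finset.mul_sum]

lemma measurable_payoff (iplus : Fin 2) (n : ℕ) :
    Measurable fun z : EuclideanSpace ℝ (Fin 2) × ℝ =>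
      p.payoff iplus n (fun j => z.1 j) z.2 := by
  simp only [payoff, bid_exp, bidBoth_exp 0]
  fun_prop

/-- The abstract hypothesis `hz` serves two settings: the actual factors under `Q`, and the identity
under a single `factorLaw`. -/
lemma ae_price_pow_eq_payoff (hm : ∀ i, 0 < p.m i) (hcap : ∀ i, 0 < p.cap i)
    (hρ : p.ρ ∈ Set.Icc (-1 : ℝ) 1) (hvar : 0 < p.varRatio) (hσd : 0 < p.σd) (iplus : Fin 2)
    (n : ℕ) {α : Type*} [MeasurableSpace α] (ν : Measure α) (z : α → EuclideanSpace ℝ (Fin 2) × ℝ)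
    (hz : ∀ P : EuclideanSpace ℝ (Fin 2) × ℝ → Prop, MeasurableSet {y | P y} →
      (∀ μ μd, ∀ᵐ y ∂(p.factorLaw μ μd), P y) → ∀ᵐ a ∂ν, P (z a)) :
    ∀ᵐ a ∂ν, p.price (p.demand (z a).2) (fun j => Real.exp ((z a).1 j)) ^ n =
      p.payoff iplus n (fun j => (z a).1 j) (z a).2 := by
  have h1 : ∀ᵐ a ∂ν, (z a).2 ≠ p.totalCap :=
    hz (fun y => y.2 ≠ p.totalCap)
      (measurableSet_eq_fun measurable_snd measurable_const).compl
      fun μ μd => ae_demand_ne μ μd hσd _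
  have h2 : ∀ i h w, ∀ᵐ a ∂ν, (z a).1 i - (z a).1 (other i) + h * (z a).2 ≠ w := fun i h w =>
    hz (fun y => y.1 i - y.1 (other i) + h * y.2 ≠ w)
      (measurableSet_eq_fun (by fun_prop) measurable_const).compl
      fun μ μd => ae_linear_ne μ μd i hρ hvar _ _
  filter_upwards [h1, ae_all_iff.2 fun i => h2 i 0 (p.threshold i 0 0),
    ae_all_iff.2 fun i => h2 i 0 (p.threshold i (p.cap i) (p.cap (other i))),
    ae_all_iff.2 fun i => h2 i (p.m i) (p.threshold i 0 0),
    ae_all_iff.2 fun i => h2 i (p.m i) (p.threshold i (-p.cap (other i)) (p.cap (other i)))]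
    with a g1 g2 g3 g4 g5
  simp only [zero_mul, add_zero] at g2 g3
  exact price_pow_eq_payoff hm hcap iplus n g1 g2 g3 g4 g5

end Params

lemma integralEq_exp_eval {p : Params} (hρ : p.ρ ∈ Set.Icc (-1 : ℝ) 1) (μ : Fin 2 → ℝ) (μd : ℝ)
    (i : Fin 2) : IntegralEq (p.factorLaw μ μd) (fun z => Real.exp (z.1 i))
      (Real.exp (μ i + p.σ i ^ 2 / 2)) := by
  have h := (Params.hasGaussianLaw_linear (p := p) μ i 1 0).fst
  have h1 := integrable_exp_of_hasGaussianLaw h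
  have h2 := integral_exp_of_hasGaussianLaw h
  rw [Params.integral_linear _ _ hρ, Params.variance_linear _ _ hρ] at h2
  simp only [one_mul, zero_mul, add_zero] at h1 h2
  refine ⟨h1.comp_fst _, ?_⟩
  rw [Params.factorLaw, integral_fun_fst (fun z : EuclideanSpace ℝ (Fin 2) => Real.exp (z i)), h2]
  simp

end BidStack

end

/-! ### Conditional moments of the electricity price -/

theorem mainTheorem9 {Ω : Type*} {mΩ : MeasurableSpace Ω}
    (Q : Measure Ω) [IsProbabilityMeasure Q] (𝓕 : Filtration ℝ≥0 mΩ)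
    (t T : ℝ≥0) (htT : t ≤ T)
    -- market and distribution parameters
    (p : BidStack.Params)
    (hm : ∀ i, 0 < p.m i) (hcap : ∀ i, 0 < p.cap i)
    (hσ : ∀ i, 0 ≤ p.σ i) (hρ : p.ρ ∈ Set.Icc (-1 : ℝ) 1) (hvar : 0 < p.varRatio)
    (hσd : 0 < p.σd)
    (iplus : Fin 2) (hiplus : ∀ i, p.cap i ≤ p.cap iplus)
    -- positive fuel price processes, and untruncated demand at maturity
    (S : Fin 2 → ℝ≥0 → Ω → ℝ) (XT : Ω → ℝ)
    (hS : ∀ i, Measurable[𝓕 T] (S i T)) (hX : Measurable[𝓕 T] XT)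
    (hSpos : ∀ i, ∀ᵐ ω ∂Q, 0 < S i T ω)
    -- conditional means given the information at time `t`
    (μ : Fin 2 → Ω → ℝ) (μd : Ω → ℝ)
    (hμ : ∀ i, Measurable[𝓕 t] (μ i)) (hμd : Measurable[𝓕 t] μd)
    -- given the information at time `t`, log fuel prices and untruncated demand are Gaussian,
    -- and the latter is independent of the former
    (hlaw : BidStack.HasCondLaw Q (𝓕 t)
      (fun ω => (WithLp.toLp 2 (fun i => Real.log (S i T ω)), XT ω))
      (fun ω => p.factorLaw (fun i => μ i ω) (μd ω)))
    (n : ℕ) :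
    let PT : Ω → ℝ := fun ω => p.price (p.demand (XT ω)) (fun i => S i T ω)
    let F : Fin 2 → Ω → ℝ := fun i => BidStack.forwardPrice Q (𝓕 t) (S i T)
    let M : Ω → ℝ := fun ω => p.momentFormula iplus n (fun i => F i ω) (μd ω)
    -- as a conditional expectation of a nonnegative random variable
    (∀ᵐ ω ∂Q, 0 ≤ PT ω) ∧
    condLExp (𝓕 t) Q (fun ω => ENNReal.ofReal (PT ω ^ n)) =ᵐ[Q] (fun ω => ENNReal.ofReal (M ω)) ∧
    (∀ᵐ ω ∂Q, 0 ≤ M ω) ∧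
    -- as an ordinary conditional expectation, when the `n`-th moment is finite
    (Integrable (fun ω => PT ω ^ n) Q → Q[fun ω => PT ω ^ n | 𝓕 t] =ᵐ[Q] M) := by
  intro PT F M
  have hS' : ∀ i, Measurable (S i T) := fun i => (hS i).mono (𝓕.le T) le_rfl
  have hX' : Measurable XT := hX.mono (𝓕.le T) le_rfl
  set Y : Ω → EuclideanSpace ℝ (Fin 2) × ℝ :=
    fun ω => (WithLp.toLp 2 (fun i => Real.log (S i T ω)), XT ω) with hYdef
  have hY : Measurable Y :=
    ((WithLp.measurable_toLp 2 _).comp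
      (measurable_pi_iff.2 fun i => Real.measurable_log.comp (hS' i))).prodMk hX'
  have hκ : Measurable[𝓕 t] fun ω => p.factorLaw (fun i => μ i ω) (μd ω) :=
    @BidStack.Params.measurable_factorLaw p Ω (𝓕 t) (fun ω i => μ i ω) μd hμ hμd
  have hκ1 : ∀ ω, IsProbabilityMeasure (p.factorLaw (fun i => μ i ω) (μd ω)) :=
    fun ω => inferInstance
  have hle := 𝓕.le t
  have hexp : ∀ᵐ ω ∂Q, ∀ i, S i T ω = Real.exp ((Y ω).1 i) :=
    ae_all_iff.2 fun i => (hSpos i).mono fun ω h => (Real.exp_log h).symm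
  have hPT : ∀ᵐ ω ∂Q, PT ω = p.price (p.demand (Y ω).2) (fun i => Real.exp ((Y ω).1 i)) := by
    filter_upwards [hexp] with ω h
    simp only [PT, h]
    rfl
  have hPTpos : ∀ᵐ ω ∂Q, 0 ≤ PT ω := by
    filter_upwards [hPT] with ω h
    rw [h]
    exact (BidStack.Params.price_demand_pos hm hcap _ _).le
  have hpay : ∀ᵐ ω ∂Q, PT ω ^ n = p.payoff iplus n (fun j => (Y ω).1 j) (Y ω).2 := by
    filter_upwards [hPT, BidStack.Params.ae_price_pow_eq_payoff hm hcap hρ hvar hσd iplus n Q Y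
      (fun P hP h => hlaw.ae_comp hle hY hκ hκ1 hP fun ω => h _ _)] with ω h1 h2
    rw [h1, h2]
  have hF : ∀ᵐ ω ∂Q, ∀ i, F i ω = Real.exp (μ i ω + p.σ i ^ 2 / 2) := by
    refine ae_all_iff.2 fun i => ?_
    have h1 : (fun ω => ENNReal.ofReal (S i T ω)) =ᵐ[Q]
        fun ω => ENNReal.ofReal (Real.exp ((Y ω).1 i)) := by
      filter_upwards [hexp] with ω h
      rw [h]
    have h2 := hlaw.condLExp_comp hle hY hκ hκ1
      (f := fun z => ENNReal.ofReal (Real.exp (z.1 i))) (by fun_prop)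
    filter_upwards [condLExp_congr_ae (mΩ := 𝓕 t) h1, h2] with ω h3 h4
    have h5 := BidStack.integralEq_exp_eval hρ (fun i => μ i ω) (μd ω) i
    simp only [F, BidStack.forwardPrice]
    rw [h3, h4, ← ofReal_integral_eq_lintegral_ofReal h5.1
      (.of_forall fun z => (Real.exp_pos _).le), h5.2, ENNReal.toReal_ofReal (Real.exp_pos _).le]
  have hint := fun ω => BidStack.Params.integralEq_payoff hm hρ hvar hσd iplus n
    (fun i => μ i ω) (μd ω)
  -- `payoff` is a signed sum; its sign is only visible off the ties, where it is a power of a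
  -- positive price.
  have hpos : ∀ ω, ∀ᵐ z ∂(p.factorLaw (fun i => μ i ω) (μd ω)),
      0 ≤ p.payoff iplus n (fun j => z.1 j) z.2 := by
    intro ω
    filter_upwards [BidStack.Params.ae_price_pow_eq_payoff hm hcap hρ hvar hσd iplus n
      (p.factorLaw (fun i => μ i ω) (μd ω)) id (fun P _ h => h _ _)] with z hz
    exact hz ▸ pow_nonneg (BidStack.Params.price_demand_pos hm hcap _ _).le n
  have hM : ∀ᵐ ω ∂Q, M ω = ∫ z, p.payoff iplus n (fun j => z.1 j) z.2
      ∂(p.factorLaw (fun i => μ i ω) (μd ω)) := by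
    filter_upwards [hF] with ω h
    rw [(hint ω).2]
    simp only [M, h]
  have hMpos : ∀ᵐ ω ∂Q, 0 ≤ M ω := by
    filter_upwards [hM] with ω h
    rw [h]
    exact integral_nonneg_of_ae (hpos ω)
  have hmain : condLExp (𝓕 t) Q (fun ω => ENNReal.ofReal (PT ω ^ n)) =ᵐ[Q]
      (fun ω => ENNReal.ofReal (M ω)) := by
    have h1 : (fun ω => ENNReal.ofReal (PT ω ^ n)) =ᵐ[Q]
        fun ω => ENNReal.ofReal (p.payoff iplus n (fun j => (Y ω).1 j) (Y ω).2) := by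
      filter_upwards [hpay] with ω h
      rw [h]
    have h2 := hlaw.condLExp_comp hle hY hκ hκ1
      (f := fun z => ENNReal.ofReal (p.payoff iplus n (fun j => z.1 j) z.2))
      (BidStack.Params.measurable_payoff iplus n).ennreal_ofReal
    filter_upwards [condLExp_congr_ae (mΩ := 𝓕 t) h1, h2, hM] with ω h3 h4 h5
    rw [h3, h4, h5, ofReal_integral_eq_lintegral_ofReal (hint ω).1 (hpos ω)]
  refine ⟨hPTpos, hmain, hMpos, fun hi => ?_⟩
  have hnn : 0 ≤ᵐ[Q] fun ω => PT ω ^ n := hPTpos.mono fun ω h => pow_nonneg h n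
  filter_upwards [condLExp_ofReal (𝓕 t) hi hnn, hmain, hMpos, condExp_nonneg (m := 𝓕 t) hnn]
    with ω h1 h2 h3 h4
  rw [h2] at h1
  exact ((ENNReal.ofReal_eq_ofReal_iff h3 h4).1 h1).symm
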